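/- For integers $k\ge 1$, $s\ge 2$ and $n\ge sk+1$, the $s$-stable Kneser graph $S(n,k,s)$ has as vertices all $k$-element subsets $A$ of $\{1,\dots,n\}$ such that any two elements $i<j$ of $A$ satisfy $j-i\ge s$ and $j-i\notin\{n-1,n-2,\dots,n-s+1\}$, and two vertices are adjacent if they are disjoint as sets. Theorem. There is a single algorithm with the following property. On input $(n,k,s)$ with $k\ge 1$, $s\ge 2$, $n\ge sk+1$, it computes a Hamilton cycle in $S(n,k,s)$: it visits all vertices of the graph, each exactly once, in the order of a Hamilton cycle, and then halts. Each visited vertex is represented in memory by its characteristic bitstring of length $n$. The algorithm takes time $O(n)$ to compute the next vertex on the cycle (in the worst case, for every vertex), its initialization time (until the first vertex is available) and the time between the last visit and halting are $O(n)$, and it uses $O(n)$ memory. The constants in the $O(n)$ bounds are absolute, that is, independent of $n$, $k$ and $s$. Time is the number of instructions of a unit-cost word RAM (addition, truncated subtraction, comparison, indirect load and store), and memory is the number of its words, each of which holds an integer that is non-negative and $O(n)$. -/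

import Mathlib

/-! ### The graphs -/

/-- `A` is `s`-stable in the cyclically ordered ground set `Fin n` (the numbers `1, …, n`, each
lowered by one): any two elements `i < j` of `A` satisfy `j - i ≥ s` and
`j - i ∉ {n - 1, n - 2, …, n - s + 1}`, the latter being `j - i + s ≤ n` since `j - i < n`. -/
def IsStable {n : ℕ} (s : ℕ) (A : Finset (Fin n)) : Prop :=
  ∀ i ∈ A, ∀ j ∈ A, i < j → s ≤ (j : ℕ) - (i : ℕ) ∧ (j : ℕ) - (i : ℕ) + s ≤ n

/-- The vertices of `S(n,k,s)`: the `s`-stable `k`-element subsets of the ground set. -/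
abbrev StableSet (n k s : ℕ) : Type :=
  {A : Finset (Fin n) // A.card = k ∧ IsStable s A}

/-- The `s`-stable Kneser graph `S(n,k,s)`: two vertices are adjacent when they are disjoint
(the inequality only matters for `k = 0`, where it excludes a loop). -/
def stableKneserGraph (n k s : ℕ) : SimpleGraph (StableSet n k s) where
  Adj A B := A ≠ B ∧ Disjoint A.1 B.1
  symm := ⟨fun _ _ h => ⟨h.1.symm, h.2.symm⟩⟩
  loopless := ⟨fun _ h => h.1 rfl⟩

/-! ### The machine: a word RAM with unit-cost instructions -/

namespace WordRAM

/-- A machine state: the registers and the random access memory, both holding natural numbers. -/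
structure State where
  reg : ℕ → ℕ
  mem : ℕ → ℕ

/-- Replace the content of one register. -/
def State.setReg (σ : State) (r v : ℕ) : State :=
  { σ with reg := Function.update σ.reg r v }

/-- Replace the content of one memory cell. -/
def State.setMem (σ : State) (a v : ℕ) : State :=
  { σ with mem := Function.update σ.mem a v }

/-- An operand of an instruction: a literal number or the content of a register. -/
inductive Operand where
  | lit (v : ℕ)
  | reg (r : ℕ)

/-- The value of an operand. -/
def Operand.val : Operand → State → ℕ
  | .lit v, _ => v
  | .reg r, σ => σ.reg r

/-- The tests that branches and loops may use. -/
inductive Test where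
  | lt (a b : Operand)
  | eq (a b : Operand)

/-- Whether a test succeeds. -/
def Test.Holds : Test → State → Prop
  | .lt a b, σ => a.val σ < b.val σ
  | .eq a b, σ => a.val σ = b.val σ

/-- Programs. As a program is a finite expression, it uses finitely many registers. -/
inductive Program where
  /-- Do nothing. -/
  | skip
  /-- `reg[r] := a` -/
  | move (r : ℕ) (a : Operand)
  /-- `reg[r] := a + b` -/
  | plus (r : ℕ) (a b : Operand)
  /-- `reg[r] := max (a - b) 0` -/
  | minus (r : ℕ) (a b : Operand)
  /-- `reg[r] := mem[a]` -/
  | load (r : ℕ) (a : Operand)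
  /-- `mem[a] := b` -/
  | store (a b : Operand)
  /-- Announce that the object now stored in memory is the next object of the output. -/
  | visit
  /-- First `P`, then `Q`. -/
  | seq (P Q : Program)
  /-- If `b` then `P` else `Q`. -/
  | branch (b : Test) (P Q : Program)
  /-- While `b` do `P`. -/
  | loop (b : Test) (P : Program)

/-- A visit: the time at which it is completed, and the content of the memory at that moment. -/
structure Visit where
  time : ℕ
  mem : ℕ → ℕ

/-- The same visit on a clock that was started `t` steps earlier. -/
def Visit.delay (t : ℕ) (v : Visit) : Visit :=
  { v with time := t + v.time }

/-- `Runs W P σ t out τ`: on a machine whose memory has the `W` cells `0, …, W - 1`, and whose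
words are the numbers `0, …, W - 1`, the program `P`, started in the state `σ`, halts after exactly
`t` steps in the state `τ`, and `out` lists the visits made on the way, in order, with the time
counted from the start of `P`. Each instruction and each evaluation of a test takes one step. A
program that computes a number that is not a word, or addresses a cell that does not exist, has no
run. -/
inductive Runs (W : ℕ) : Program → State → ℕ → List Visit → State → Prop where
  | skip (σ : State) : Runs W .skip σ 1 [] σ
  | move (σ : State) (r : ℕ) (a : Operand) (h : a.val σ < W) :
      Runs W (.move r a) σ 1 [] (σ.setReg r (a.val σ))
  | plus (σ : State) (r : ℕ) (a b : Operand) (h : a.val σ + b.val σ < W) :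
      Runs W (.plus r a b) σ 1 [] (σ.setReg r (a.val σ + b.val σ))
  | minus (σ : State) (r : ℕ) (a b : Operand) (h : a.val σ - b.val σ < W) :
      Runs W (.minus r a b) σ 1 [] (σ.setReg r (a.val σ - b.val σ))
  | load (σ : State) (r : ℕ) (a : Operand) (h : a.val σ < W) :
      Runs W (.load r a) σ 1 [] (σ.setReg r (σ.mem (a.val σ)))
  | store (σ : State) (a b : Operand) (ha : a.val σ < W) (hb : b.val σ < W) :
      Runs W (.store a b) σ 1 [] (σ.setMem (a.val σ) (b.val σ))
  | visit (σ : State) : Runs W .visit σ 1 [⟨1, σ.mem⟩] σ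
  | seq {P Q : Program} {σ₁ σ₂ σ₃ : State} {t₁ t₂ : ℕ} {out₁ out₂ : List Visit}
      (hP : Runs W P σ₁ t₁ out₁ σ₂) (hQ : Runs W Q σ₂ t₂ out₂ σ₃) :
      Runs W (.seq P Q) σ₁ (t₁ + t₂) (out₁ ++ out₂.map (Visit.delay t₁)) σ₃
  | branch_true {b : Test} {P Q : Program} {σ τ : State} {t : ℕ} {out : List Visit}
      (hb : b.Holds σ) (hP : Runs W P σ t out τ) :
      Runs W (.branch b P Q) σ (1 + t) (out.map (Visit.delay 1)) τ
  | branch_false {b : Test} {P Q : Program} {σ τ : State} {t : ℕ} {out : List Visit}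
      (hb : ¬ b.Holds σ) (hQ : Runs W Q σ t out τ) :
      Runs W (.branch b P Q) σ (1 + t) (out.map (Visit.delay 1)) τ
  | loop_done {b : Test} {P : Program} {σ : State} (hb : ¬ b.Holds σ) :
      Runs W (.loop b P) σ 1 [] σ
  | loop_again {b : Test} {P : Program} {σ₁ σ₂ σ₃ : State} {t₁ t₂ : ℕ} {out₁ out₂ : List Visit}
      (hb : b.Holds σ₁) (hP : Runs W P σ₁ t₁ out₁ σ₂) (hL : Runs W (.loop b P) σ₂ t₂ out₂ σ₃) :
      Runs W (.loop b P) σ₁ (1 + t₁ + t₂)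
        (out₁.map (Visit.delay 1) ++ out₂.map (Visit.delay (1 + t₁))) σ₃

/-- The initial state on the input `(n, k, s)`: the input is in the registers `0`, `1`, `2`, and
all other registers and all memory cells hold `0`. -/
def State.input (n k s : ℕ) : State where
  reg := fun r => if r = 0 then n else if r = 1 then k else if r = 2 then s else 0
  mem := fun _ => 0

/-- The memory cells `0, …, n - 1` hold the characteristic bitstring of `A`. -/
def Stores {n : ℕ} (mem : ℕ → ℕ) (A : Finset (Fin n)) : Prop :=
  ∀ i : Fin n, mem i = if i ∈ A then 1 else 0

end WordRAM

/-! Vertices are read as cyclic 0/1-words. Since `s ≥ 2`, a vertex is disjoint from its rotation by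
one position, so each orbit of `rot` is a closed walk in the graph, and these walks are to be glued
along a tree of orbits.

Call a 1 big if at least `s` zeros follow it, so that it can move one place to the right. The
lexicographically smallest rotation of a word ends with a big 1 (`isBig_last`). The rotation that
starts at the preceding big 1 is the source of the orbit. It is unique as a word
(`IsSource.unique`), and it exists unless all gaps but one have length `s`, which happens only in
the orbit of `start` (`exists_source`). Moving the leading 1 of a source one place to the right
(`swapFirst`) leads to an orbit with a smaller smallest rotation (`minRot_swapFirst_lt`). Hence the
orbits form a tree with root the orbit of `start`.

Write `ρ` for `rot` and `κ` for `swapFirst`. Gluing at a source `a` replaces the edges between `a`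
and `ρ a` and between `ρ (κ a)` and `ρ (ρ (κ a))` by edges between `a` and `ρ (κ a)` and between `ρ
a` and `ρ (ρ (κ a))`; the new pairs are disjoint too (`adj_rot_swapFirst`). If the directions of
traversal alternate along the tree (`exists_dir`), each gluing is the composition with a
transposition of points of two different cycles, which merges these (`SameCycle.mul_swap_self`). The
transpositions are pairwise disjoint, so the successor of a vertex is determined by its direction
and by whether it is an end point of a gluing (`exists_successor`).

The algorithm therefore keeps only the current word, one bit for the direction, and a copy of the
start vertex. A few letters reveal whether the vertex may be an end point of a gluing, and which
source would belong to it. The source property is decided by a scan for the next big 1 and by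
Duval's algorithm, which tests in linear time whether the rotation behind that 1 is smallest. A step
is thus a bounded number of linear passes (`advance_spec`). The run ends when the start vertex
returns, which cannot happen early on a single cycle. -/

namespace WordRAM

/-! ### A program logic with running times -/

/-- Worst-case number of steps of a program without loops. -/
def Program.cost : Program → ℕ
  | .seq P Q => P.cost + Q.cost
  | .branch _ P Q => 1 + max P.cost Q.cost
  | _ => 1

/-- Weakest precondition of a program without loops and visits on a machine with word bound `W`. -/
def Program.wp (W : ℕ) : Program → (State → Prop) → State → Prop
  | .skip, Q, σ => Q σ
  | .move r a, Q, σ => a.val σ < W ∧ Q (σ.setReg r (a.val σ))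
  | .plus r a b, Q, σ => a.val σ + b.val σ < W ∧ Q (σ.setReg r (a.val σ + b.val σ))
  | .minus r a b, Q, σ => a.val σ - b.val σ < W ∧ Q (σ.setReg r (a.val σ - b.val σ))
  | .load r a, Q, σ => a.val σ < W ∧ Q (σ.setReg r (σ.mem (a.val σ)))
  | .store a b, Q, σ => a.val σ < W ∧ b.val σ < W ∧ Q (σ.setMem (a.val σ) (b.val σ))
  | .visit, _, _ => False
  | .seq P P', Q, σ => P.wp W (P'.wp W Q) σ
  | .branch b P P', Q, σ => (b.Holds σ → P.wp W Q σ) ∧ (¬ b.Holds σ → P'.wp W Q σ)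
  | .loop _ _, _, _ => False

/-- `P` halts from `σ` within `N` steps, without visits, in a state satisfying `Q`. -/
def Ends (W : ℕ) (P : Program) (σ : State) (N : ℕ) (Q : State → Prop) : Prop :=
  ∃ t τ, t ≤ N ∧ Runs W P σ t [] τ ∧ Q τ

theorem Ends.imp {W : ℕ} {P : Program} {σ : State} {N N' : ℕ} {Q Q' : State → Prop}
    (h : Ends W P σ N Q) (hN : N ≤ N') (hQ : ∀ τ, Q τ → Q' τ) : Ends W P σ N' Q' := by
  obtain ⟨t, τ, ht, hr, hq⟩ := h
  exact ⟨t, τ, ht.trans hN, hr, hQ τ hq⟩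

theorem Ends.seq {W : ℕ} {P P' : Program} {σ : State} {N N' : ℕ} {Q Q' : State → Prop}
    (h : Ends W P σ N Q) (h' : ∀ τ, Q τ → Ends W P' τ N' Q') :
    Ends W (.seq P P') σ (N + N') Q' := by
  obtain ⟨t, τ, ht, hr, hq⟩ := h
  obtain ⟨t', τ', ht', hr', hq'⟩ := h' τ hq
  exact ⟨t + t', τ', by omega, by simpa using Runs.seq hr hr', hq'⟩

theorem Ends.branch {W : ℕ} {b : Test} {P P' : Program} {σ : State} {N : ℕ} {Q : State → Prop}
    (h : b.Holds σ → Ends W P σ N Q) (h' : ¬ b.Holds σ → Ends W P' σ N Q) :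
    Ends W (.branch b P P') σ (1 + N) Q := by
  by_cases hb : b.Holds σ
  · obtain ⟨t, τ, ht, hr, hq⟩ := h hb
    exact ⟨1 + t, τ, by omega, by simpa using Runs.branch_true (Q := P') hb hr, hq⟩
  · obtain ⟨t, τ, ht, hr, hq⟩ := h' hb
    exact ⟨1 + t, τ, by omega, by simpa using Runs.branch_false (P := P) hb hr, hq⟩

/-- Visits and loops have precondition `False`, so these cases are vacuous; they are covered by
`Ends.loop` and `Runs.loop_visit`. -/
theorem Program.wp_sound {W : ℕ} (P : Program) {σ : State} {Q : State → Prop}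
    (h : P.wp W Q σ) : Ends W P σ P.cost Q := by
  induction P generalizing σ Q with
  | skip => exact ⟨1, σ, le_rfl, .skip σ, h⟩
  | move r a => exact ⟨1, _, le_rfl, .move σ r a h.1, h.2⟩
  | plus r a b => exact ⟨1, _, le_rfl, .plus σ r a b h.1, h.2⟩
  | minus r a b => exact ⟨1, _, le_rfl, .minus σ r a b h.1, h.2⟩
  | load r a => exact ⟨1, _, le_rfl, .load σ r a h.1, h.2⟩
  | store a b => exact ⟨1, _, le_rfl, .store σ a b h.1 h.2.1, h.2.2⟩
  | visit => exact h.elim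
  | seq P P' ih ih' => exact Ends.seq (ih h) fun τ hτ => ih' hτ
  | branch b P P' ih ih' =>
    exact Ends.branch (fun hb => (ih (h.1 hb)).imp (le_max_left _ _) fun _ => id)
      (fun hb => (ih' (h.2 hb)).imp (le_max_right _ _) fun _ => id)
  | loop b P => exact h.elim

/-- A loop whose invariant counts the remaining rounds. -/
theorem Ends.loop {W : ℕ} {b : Test} {P : Program} {N : ℕ} (I : ℕ → State → Prop)
    (hs : ∀ m σ, I (m + 1) σ → b.Holds σ ∧ Ends W P σ N (I m))
    (h0 : ∀ σ, I 0 σ → ¬ b.Holds σ) (m : ℕ) (σ : State) (h : I m σ) :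
    Ends W (.loop b P) σ (m * (N + 1) + 1) (I 0) := by
  induction m generalizing σ with
  | zero => exact ⟨1, σ, by omega, .loop_done (h0 σ h), h⟩
  | succ m ih =>
    obtain ⟨hb, t, τ, ht, hr, hq⟩ := hs m σ h
    obtain ⟨t', τ', ht', hr', hq'⟩ := ih τ hq
    refine ⟨1 + t + t', τ', ?_, by simpa using Runs.loop_again hb hr hr', hq'⟩
    have : (m + 1) * (N + 1) = m * (N + 1) + (N + 1) := by ring
    omega

/-- A loop that visits the objects `m`, `m - 1`, …, `1` at the beginning of its rounds. -/
theorem Runs.loop_visit {W : ℕ} {b : Test} {P : Program} {N : ℕ} (I : ℕ → State → Prop)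
    (hs : ∀ m σ, I (m + 1) σ → b.Holds σ ∧ Ends W P σ N (I m))
    (h0 : ∀ σ, I 0 σ → ¬ b.Holds σ) (m : ℕ) (σ : State) (h : I m σ) :
    ∃ T out τ, Runs W (.loop b (.seq .visit P)) σ T out τ ∧
      List.Forall₂ (fun v j => ∃ σ', I (j + 1) σ' ∧ v.mem = σ'.mem) out (List.range m).reverse ∧
      ∀ t₀ t B, t + 2 ≤ t₀ + B → N + 2 ≤ B →
        List.IsChain (fun t t' => t' ≤ t + B)
          (t₀ :: (out.map (Visit.delay t)).map Visit.time ++ [t + T]) := by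
  induction m generalizing σ with
  | zero =>
    refine ⟨1, [], σ, .loop_done (h0 σ h), by simp, fun t₀ t B h1 h2 => ?_⟩
    simp
    omega
  | succ m ih =>
    obtain ⟨hb, t₁, τ, ht, hr, hq⟩ := hs m σ h
    obtain ⟨T, out, τ', hT, hout, hc⟩ := ih τ hq
    have hrun := Runs.loop_again hb (Runs.seq (.visit σ) hr) hT
    refine ⟨_, _, τ', hrun, ?_, ?_⟩
    · rw [List.range_succ]
      simp only [List.map_nil, List.append_nil, List.map_cons, List.reverse_append,
        List.reverse_cons, List.reverse_nil, List.nil_append, List.cons_append]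
      refine List.Forall₂.cons ⟨σ, h, rfl⟩ ?_
      rw [List.forall₂_map_left_iff]
      exact hout
    · intro t₀ t B h1 h2
      -- On the absolute clock, `t₀` is the previous visit and `t` the start of this round. The test
      -- and the visit take two steps, so the visit is completed at `t + 2`, and the next round
      -- starts `t₁` steps later.
      have key := hc (t + 2) (t + (1 + (1 + t₁))) B (by omega) h2
      simp only [List.map_nil, List.append_nil, List.map_cons, List.nil_append, List.cons_append,
        List.map_map, List.isChain_cons_cons] at key ⊢
      refine ⟨by simp only [Visit.delay]; omega, ?_⟩
      have e₁ : out.map (Visit.time ∘ Visit.delay t ∘ Visit.delay (1 + (1 + t₁))) =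
          out.map (Visit.time ∘ Visit.delay (t + (1 + (1 + t₁)))) := by
        apply List.map_congr_left
        intro v _
        simp only [Function.comp, Visit.delay]
        omega
      have e₂ : t + (1 + (1 + t₁) + T) = t + (1 + (1 + t₁)) + T := by omega
      have e₃ : (Visit.delay t (Visit.delay 1 ⟨1, σ.mem⟩)).time = t + 2 := by
        simp only [Visit.delay]
      rw [e₁, e₂, e₃]
      exact key

end WordRAM

/-! ### Words -/

/-- The word `b` without its first `j` letters. -/
def shiftWord (j : ℕ) (b : ℕ → ℕ) : ℕ → ℕ := fun i => b (j + i)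

theorem shiftWord_shiftWord (i j : ℕ) (b : ℕ → ℕ) :
    shiftWord i (shiftWord j b) = shiftWord (j + i) b := by
  funext t
  simp only [shiftWord, Nat.add_assoc]

/-- The infinite words `u` and `v` have a first difference, and there `u` is smaller. -/
def LexLT (u v : ℕ → ℕ) : Prop := ∃ q, (∀ t < q, u t = v t) ∧ u q < v q

theorem lexLT_iff {u v : ℕ → ℕ} : LexLT u v ↔ toLex u < toLex v := Iff.rfl

/-- No shift of the word is lexicographically smaller. -/
def IsMinWord (b : ℕ → ℕ) : Prop := ∀ j, ¬ LexLT (shiftWord j b) b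

/-- What Duval's algorithm knows about a periodic word after reading the letters below `i`: these
have period `p`, and the suffixes that start before `p` are larger than the word. -/
def DuvalInv (b : ℕ → ℕ) (i p : ℕ) : Prop :=
  1 ≤ p ∧ p ≤ i ∧ (∀ t, t + p < i → b (t + p) = b t) ∧
    ∀ j, 0 < j → j < p → ∃ q, j + q < i ∧ (∀ t < q, b (j + t) = b t) ∧ b q < b (j + q)

theorem duvalInv_one (b : ℕ → ℕ) : DuvalInv b 1 1 :=
  ⟨le_rfl, le_rfl, fun t ht => by omega, fun j h1 h2 => by omega⟩

theorem DuvalInv.eq {b : ℕ → ℕ} {i p : ℕ} (h : DuvalInv b i p) (hb : b i = b (i - p)) :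
    DuvalInv b (i + 1) p := by
  obtain ⟨h1, h2, h3, h4⟩ := h
  refine ⟨h1, by omega, fun t ht => ?_, fun j hj hjp => ?_⟩
  · rcases Nat.lt_or_ge (t + p) i with h | h
    · exact h3 t h
    · have e1 : t + p = i := by omega
      have e2 : t = i - p := by omega
      rw [e1, hb, e2]
  · obtain ⟨q, hq, h⟩ := h4 j hj hjp
    exact ⟨q, by omega, h⟩

theorem period_mul {b : ℕ → ℕ} {i p : ℕ} (h : ∀ t, t + p < i → b (t + p) = b t) (m t : ℕ)
    (ht : t + p * m < i) : b (t + p * m) = b t := by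
  induction m with
  | zero => simp
  | succ m ih =>
    rw [Nat.mul_succ, ← Nat.add_assoc] at ht ⊢
    rw [h _ ht, ih (by omega)]

/-- A suffix that starts at `r + p * m` copies the one at `r` until this one's first difference or
until position `i`. At either place the suffix is larger than the prefix, so no proper suffix
survives as a competitor and the whole prefix becomes the period. -/
theorem DuvalInv.gt {b : ℕ → ℕ} {i p : ℕ} (h : DuvalInv b i p) (hb : b (i - p) < b i) :
    DuvalInv b (i + 1) (i + 1) := by
  obtain ⟨h1, h2, h3, h4⟩ := h
  have hper := period_mul h3
  refine ⟨by omega, le_rfl, fun t ht => by omega, fun j hj hji => ?_⟩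
  obtain ⟨r, m, hr, hjm⟩ : ∃ r m, r < p ∧ j = r + p * m :=
    ⟨j % p, j / p, Nat.mod_lt _ h1, (Nat.mod_add_div j p).symm⟩
  -- For `m > 0`, the letter that periodicity predicts for position `i` is `b (r + t)`.
  have hlast : ∀ t, r + t + p * m = i → 0 < m → b (i - p) = b (r + t) := by
    intro t ht hm
    obtain ⟨m, rfl⟩ : ∃ m', m = m' + 1 := ⟨m - 1, by omega⟩
    have e : i - p = r + t + p * m := by rw [Nat.mul_succ] at ht; omega
    rw [e, hper m (r + t) (by rw [Nat.mul_succ] at ht; omega)]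
  rcases Nat.eq_zero_or_pos r with hr0 | hr0
  · have hm : 0 < m := by
      rcases Nat.eq_zero_or_pos m with h | h
      · subst h; omega
      · exact h
    refine ⟨i - j, by omega, fun t ht => ?_, ?_⟩
    · have e : j + t = t + p * m := by omega
      rw [e, hper m t (by omega)]
    · have e : j + (i - j) = i := by omega
      have := hlast (i - j) (by omega) hm
      rw [e]
      rw [hr0, Nat.zero_add] at this
      omega
  · obtain ⟨q, hq, hqt, hqb⟩ := h4 r hr0 hr
    rcases Nat.eq_zero_or_pos m with hm | hm
    · subst hm
      have e : j = r := by omega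
      subst e
      exact ⟨q, by omega, hqt, hqb⟩
    -- The first difference of the suffix at `r`, moved by `p * m`, falls before `i` and is copied,
    -- falls on `i` and is only increased by the new letter, or falls beyond `i`, where the new
    -- letter is itself the first difference.
    rcases lt_trichotomy (j + q) i with h | h | h
    · refine ⟨q, by omega, fun t ht => ?_, ?_⟩
      · have e : j + t = r + t + p * m := by omega
        rw [e, hper m _ (by omega), hqt t ht]
      · have e : j + q = r + q + p * m := by omega
        rw [e, hper m _ (by omega)]
        exact hqb
    · refine ⟨q, by omega, fun t ht => ?_, ?_⟩
      · have e : j + t = r + t + p * m := by omega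
        rw [e, hper m _ (by omega), hqt t ht]
      · have := hlast q (by omega) hm
        rw [h]
        omega
    · refine ⟨i - j, by omega, fun t ht => ?_, ?_⟩
      · have e : j + t = r + t + p * m := by omega
        rw [e, hper m _ (by omega), hqt t (by omega)]
      · have e : j + (i - j) = i := by omega
        have := hlast (i - j) (by omega) hm
        rw [hqt (i - j) (by omega)] at this
        rw [e]
        omega

theorem DuvalInv.lt {b : ℕ → ℕ} {i p : ℕ} (h : DuvalInv b i p) (hb : b i < b (i - p)) :
    ¬ IsMinWord b := by
  obtain ⟨h1, h2, h3, -⟩ := h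
  intro hmin
  refine hmin p ⟨i - p, fun t ht => ?_, ?_⟩
  · rw [shiftWord, Nat.add_comm]
    exact h3 t (by omega)
  · have e : p + (i - p) = i := by omega
    rw [shiftWord, e]
    exact hb

theorem periodic_mul {b : ℕ → ℕ} {n : ℕ} (hb : ∀ i, b (i + n) = b i) (m i : ℕ) :
    b (i + n * m) = b i :=
  period_mul (i := i + n * m + 1) (fun t _ => hb t) m i (by omega)

theorem periodic_mod {b : ℕ → ℕ} {n : ℕ} (hb : ∀ i, b (i + n) = b i) (i : ℕ) :
    b (i % n) = b i := by
  conv_rhs => rw [← Nat.mod_add_div i n, periodic_mul hb]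

/-- Two periods suffice: comparing a shift by less than `n` on `n` letters reads only positions
below `2 * n`, and agreement on `n` letters is equality of periodic words. -/
theorem DuvalInv.isMinWord {b : ℕ → ℕ} {n p : ℕ} (hn : 0 < n) (hb : ∀ i, b (i + n) = b i)
    (h : DuvalInv b (2 * n) p) : IsMinWord b := by
  obtain ⟨h1, h2, h3, h4⟩ := h
  have hper := period_mul h3
  -- it suffices to compare shifts below `n` on the first `n` letters
  have key : ∀ j < n, (∀ t < n, b (j + t) = b t) ∨
      ∃ q, (∀ t < q, b (j + t) = b t) ∧ b q < b (j + q) := by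
    intro j hj
    obtain ⟨r, m, hr, hjm⟩ : ∃ r m, r < p ∧ j = r + p * m :=
      ⟨j % p, j / p, Nat.mod_lt _ h1, (Nat.mod_add_div j p).symm⟩
    have hrt : ∀ t < n, b (j + t) = b (r + t) := by
      intro t ht
      have e : j + t = r + t + p * m := by omega
      rw [e, hper m _ (by omega)]
    rcases Nat.eq_zero_or_pos r with hr0 | hr0
    · left
      intro t ht
      rw [hrt t ht, hr0, Nat.zero_add]
    · obtain ⟨q, hq, hqt, hqb⟩ := h4 r hr0 hr
      rcases Nat.lt_or_ge q n with h | h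
      · right
        refine ⟨q, fun t ht => ?_, ?_⟩
        · rw [hrt t (by omega), hqt t ht]
        · rw [hrt q h]
          exact hqb
      · left
        intro t ht
        rw [hrt t ht, hqt t (by omega)]
  rintro j ⟨q, hqt, hq⟩
  have hj : ∀ t, b (j + t) = b (j % n + t) := by
    intro t
    rw [← periodic_mod hb (j + t), ← periodic_mod hb (j % n + t), Nat.mod_add_mod]
  simp only [shiftWord, hj] at hqt hq
  rcases key (j % n) (Nat.mod_lt _ hn) with h | ⟨q', h, h'⟩
  · have := h (q % n) (Nat.mod_lt _ hn)
    rw [periodic_mod hb q, ← periodic_mod hb (j % n + q % n), Nat.add_mod_mod,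
      periodic_mod hb] at this
    omega
  · rcases lt_trichotomy q q' with hh | hh | hh
    · have := h q hh; omega
    · subst hh; omega
    · have := hqt q' hh; omega

/-! ### Merging the cycles of a permutation along a tree -/

namespace Equiv.Perm
variable {V : Type*}

/-- The new permutation sends `b` to `σ a` and agrees with `σ` on the cycle of `a` except at `a`,
since `b` is not on it. So from `b` it runs through this whole cycle. -/
theorem SameCycle.mul_swap_aux [DecidableEq V] [Finite V] {σ : Perm V} {a b : V}
    (h : ¬ SameCycle σ a b) {x : V} (hx : SameCycle σ a x) :
    SameCycle (σ * swap a b) b x := by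
  obtain ⟨i, hi⟩ := hx.exists_nat_pow_eq
  have hx' : SameCycle σ (σ a) x := (sameCycle_apply_left).2 hx
  obtain ⟨i, rfl⟩ := hx'.exists_nat_pow_eq
  clear hx hx' hi
  have hb : (σ * swap a b) b = σ a := by simp
  induction i with
  | zero => exact ⟨1, by simp⟩
  | succ i ih =>
    rw [pow_succ', mul_apply]
    set x := (σ ^ i) (σ a) with hxdef
    have hax : SameCycle σ a x := ⟨i + 1, by rw [zpow_add, zpow_one, mul_apply, hxdef]; rfl⟩
    by_cases hxa : x = a
    · rw [hxa, ← hb]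
      exact (sameCycle_apply_right).2 (SameCycle.refl _ _)
    · have hxb : x ≠ b := fun e => h (e ▸ hax)
      have : (σ * swap a b) x = σ x := by simp [swap_apply_of_ne_of_ne hxa hxb]
      rw [← this]
      exact (sameCycle_apply_right).2 ih

/-- Multiplying by a transposition of points of two different cycles merges these cycles. -/
theorem SameCycle.mul_swap_self [DecidableEq V] [Finite V] {σ : Perm V} {a b : V}
    (h : ¬ SameCycle σ a b) : SameCycle (σ * swap a b) a b :=
  (SameCycle.mul_swap_aux h (SameCycle.refl _ _)).symm

theorem SameCycle.mul_swap [DecidableEq V] [Finite V] {σ : Perm V} {a b x y : V}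
    (h : ¬ SameCycle σ a b) (hxy : SameCycle σ x y) : SameCycle (σ * swap a b) x y := by
  by_cases hax : SameCycle σ a x
  · exact (mul_swap_aux h hax).symm.trans (mul_swap_aux h (hax.trans hxy))
  by_cases hbx : SameCycle σ b x
  · have h' : ¬ SameCycle σ b a := fun e => h e.symm
    rw [swap_comm]
    exact (mul_swap_aux h' hbx).symm.trans (mul_swap_aux h' (hbx.trans hxy))
  obtain ⟨i, rfl⟩ := hxy.exists_nat_pow_eq
  refine ⟨i, ?_⟩
  rw [zpow_natCast]
  induction i with
  | zero => simp
  | succ i ih =>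
    rw [pow_succ', mul_apply, ih ⟨i, by simp⟩, pow_succ', mul_apply, mul_apply,
      swap_apply_of_ne_of_ne]
    · intro e
      exact hax (e ▸ ⟨-i, by simp⟩)
    · intro e
      exact hbx (e ▸ ⟨-i, by simp⟩)

/-- Data for joining the cycles of `ρ` along a tree: every source `a` joins its cycle to the cycle
of `κ a`, which has smaller rank. -/
structure Gluing {V R : Type*} [LinearOrder R] (ρ : Perm V) (κ : V → V) (S : Set V)
    (rank : V → R) : Prop where
  rank_rot : ∀ v, rank (ρ v) = rank v
  rank_lt : ∀ a ∈ S, rank (κ a) < rank a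
  unique : ∀ a ∈ S, ∀ b ∈ S, SameCycle ρ a b → a = b
  inj : ∀ a ∈ S, ∀ b ∈ S, κ a = κ b → a = b
  disj : ∀ a ∈ S, ∀ b ∈ S, a ≠ ρ (κ b)

/-- The rotation `ρ`, in the direction given by `D`. -/
def dirPerm (ρ : Perm V) (D : V → Bool) (hD : ∀ v, D (ρ v) = D v) : Perm V where
  toFun v := if D v then ρ v else ρ.symm v
  invFun v := if D v then ρ.symm v else ρ v
  left_inv v := by
    have h := hD (ρ.symm v)
    rw [apply_symm_apply] at h
    cases hv : D v <;> simp_all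
  right_inv v := by
    have h := hD (ρ.symm v)
    rw [apply_symm_apply] at h
    cases hv : D v <;> simp_all

namespace Gluing
variable {R : Type*} [LinearOrder R] {ρ : Perm V} {κ : V → V} {S : Set V} {rank : V → R}

theorem rank_eq (G : Gluing ρ κ S rank) [Finite V] {x y : V} (h : SameCycle ρ x y) :
    rank x = rank y := by
  obtain ⟨i, rfl⟩ := h.exists_nat_pow_eq
  clear h
  induction i with
  | zero => simp
  | succ i ih => rw [pow_succ', mul_apply, G.rank_rot, ih]

/-- Well-foundedness comes from finiteness of `V`; the lexicographic order on infinite words, used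
as `R` later, does not have it. -/
theorem wf [Finite V] (rank : V → R) : WellFounded (fun x y : V => rank x < rank y) := by
  have : IsTrans V (fun x y : V => rank x < rank y) := ⟨fun _ _ _ => lt_trans⟩
  have : Std.Irrefl (fun x y : V => rank x < rank y) := ⟨fun _ => lt_irrefl _⟩
  exact Finite.wellFounded_of_trans_of_irrefl _

/-- There is a choice of directions, constant on cycles and alternating along the tree. -/
theorem exists_dir [Finite V] (G : Gluing ρ κ S rank) (v₀ : V) :
    ∃ D : V → Bool, (∀ v, D (ρ v) = D v) ∧ (∀ a ∈ S, D (κ a) = !D a) ∧ D v₀ = true := by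
  classical
  suffices h : ∃ D : V → Bool, (∀ v, D (ρ v) = D v) ∧ ∀ a ∈ S, D (κ a) = !D a by
    obtain ⟨D, h1, h2⟩ := h
    -- Comparing with the value at `v₀` reverses all directions if necessary and keeps them
    -- alternating.
    refine ⟨fun v => D v == D v₀, fun v => by simp only [h1], fun a ha => ?_, by simp⟩
    simp only [h2 a ha]
    cases D a <;> cases D v₀ <;> rfl
  -- Recursion on the rank: an orbit with a source takes the direction opposite to that of its
  -- parent, and an orbit without one gets the default `true`.
  let F : (v : V) → ((w : V) → rank w < rank v → Bool) → Bool := fun v f =>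
    if h : ∃ a ∈ S, SameCycle ρ a v then
      !f (κ h.choose) (by
        rw [← G.rank_eq h.choose_spec.2]; exact G.rank_lt _ h.choose_spec.1)
    else true
  let D : V → Bool := (wf rank).fix F
  have hF : ∀ v, D v = F v fun w _ => D w := fun v => (wf rank).fix_eq F v
  have key : ∀ a ∈ S, ∀ v, SameCycle ρ a v → D v = !D (κ a) := by
    intro a ha v hv
    have h : ∃ a ∈ S, SameCycle ρ a v := ⟨a, ha, hv⟩
    rw [hF v]
    simp only [F]
    rw [dif_pos h, G.unique _ h.choose_spec.1 a ha (h.choose_spec.2.trans hv.symm)]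
  refine ⟨D, fun v => ?_, fun a ha => by rw [key a ha a (SameCycle.refl _ _)]; simp⟩
  by_cases h : ∃ a ∈ S, SameCycle ρ a v
  · obtain ⟨a, ha, hv⟩ := h
    rw [key a ha v hv, key a ha _ (sameCycle_apply_right.2 hv)]
  · rw [hF v, hF (ρ v)]
    simp only [F]
    rw [dif_neg h, dif_neg]
    rintro ⟨a, ha, hv⟩
    exact h ⟨a, ha, sameCycle_apply_right.1 hv⟩

variable (ρ κ) in
/-- The first point of the transposition that glues at `a`. -/
def fst (D : V → Bool) (a : V) : V := if D a then a else ρ a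

variable (ρ κ) in
/-- The second point of the transposition that glues at `a`. -/
def snd (D : V → Bool) (a : V) : V := if D a then ρ (ρ (κ a)) else ρ (κ a)

theorem sameCycle_fst (D : V → Bool) (a : V) : SameCycle ρ a (fst ρ D a) := by
  unfold fst
  split_ifs
  · exact SameCycle.refl _ _
  · exact sameCycle_apply_right.2 (SameCycle.refl _ _)

theorem sameCycle_snd (D : V → Bool) (a : V) : SameCycle ρ (κ a) (snd ρ κ D a) := by
  unfold snd
  split_ifs
  · exact sameCycle_apply_right.2 (sameCycle_apply_right.2 (SameCycle.refl _ _))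
  · exact sameCycle_apply_right.2 (SameCycle.refl _ _)

theorem dir_eq {D : V → Bool} (hD : ∀ v, D (ρ v) = D v) [Finite V] {x y : V}
    (h : SameCycle ρ x y) : D x = D y := by
  obtain ⟨i, rfl⟩ := h.exists_nat_pow_eq
  clear h
  induction i with
  | zero => simp
  | succ i ih => rw [pow_succ', mul_apply, hD, ih]

/-- A common point has one direction, which is opposite to both `D a` and `D b`. So both points are
given by the same formula, and injectivity of `κ` on sources applies. -/
theorem snd_injOn (G : Gluing ρ κ S rank) [Finite V] {D : V → Bool} (hD : ∀ v, D (ρ v) = D v)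
    (hκ : ∀ a ∈ S, D (κ a) = !D a) {a b : V} (ha : a ∈ S) (hb : b ∈ S)
    (h : snd ρ κ D a = snd ρ κ D b) : a = b := by
  have h1 := dir_eq hD (sameCycle_snd (κ := κ) D a)
  have h2 := dir_eq hD (sameCycle_snd (κ := κ) D b)
  rw [h, ← h2, hκ a ha, hκ b hb] at h1
  apply G.inj a ha b hb
  unfold snd at h
  cases hda : D a <;> cases hdb : D b <;> simp_all

/-- At a common point `D a` and `D b` would be opposite; in both cases the equation reduces to `a =
ρ (κ b)`. -/
theorem fst_ne_snd (G : Gluing ρ κ S rank) [Finite V] {D : V → Bool} (hD : ∀ v, D (ρ v) = D v)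
    (hκ : ∀ a ∈ S, D (κ a) = !D a) {a b : V} (ha : a ∈ S) (hb : b ∈ S) :
    fst ρ D a ≠ snd ρ κ D b := by
  intro h
  have h1 := dir_eq hD (sameCycle_fst (ρ := ρ) D a)
  have h2 := dir_eq hD (sameCycle_snd (κ := κ) D b)
  rw [h, ← h2, hκ b hb] at h1
  have := G.disj a ha b hb
  unfold fst snd at h
  cases hda : D a <;> cases hdb : D b <;> simp_all

/-- The transpositions are added by increasing rank of their sources. When `a` is added its orbit is
still untouched, because all earlier gluings touch only orbits of other sources and orbits of
strictly smaller rank. Hence its cycle is different from that of `κ a`, and the transposition merges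
them. -/
theorem exists_glued_aux [Fintype V] [DecidableEq V] (G : Gluing ρ κ S rank) {D : V → Bool}
    (hD : ∀ v, D (ρ v) = D v) (hκ : ∀ a ∈ S, D (κ a) = !D a) (T : Finset V) :
    (∀ a ∈ T, a ∈ S) → ∃ σ : Perm V,
      (∀ a ∈ T, σ (fst ρ D a) = dirPerm ρ D hD (snd ρ κ D a) ∧
        σ (snd ρ κ D a) = dirPerm ρ D hD (fst ρ D a)) ∧
      (∀ x, (∀ a ∈ T, x ≠ fst ρ D a ∧ x ≠ snd ρ κ D a) → σ x = dirPerm ρ D hD x) ∧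
      (∀ x y, SameCycle ρ x y → SameCycle σ x y) ∧ ∀ a ∈ T, SameCycle σ a (κ a) := by
  induction T using Finset.induction_on_max_value rank with
  | empty =>
    refine fun _ => ⟨dirPerm ρ D hD, by simp, by simp, fun x y h => ?_, by simp⟩
    obtain ⟨i, rfl⟩ := h.exists_nat_pow_eq
    clear h
    induction i with
    | zero => exact SameCycle.refl _ _
    | succ i ih =>
      refine ih.trans ?_
      rw [pow_succ', mul_apply]
      set z := (ρ ^ i) x
      cases hz : D z
      · have : dirPerm ρ D hD (ρ z) = z := by simp [dirPerm, hD, hz]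
        refine SameCycle.symm ⟨1, ?_⟩
        rwa [zpow_one]
      · have : dirPerm ρ D hD z = ρ z := by simp [dirPerm, hz]
        rw [← this]
        exact sameCycle_apply_right.2 (SameCycle.refl _ _)
  | insert a T haT hmax ih =>
    intro hS
    have haS : a ∈ S := hS a (by simp)
    obtain ⟨σ, h1, h2, h3, h4⟩ := ih fun b hb => hS b (by simp [hb])
    have hTS : ∀ b ∈ T, b ∈ S := fun b hb => hS b (by simp [hb])
    have hnot : ¬ SameCycle σ (fst ρ D a) (snd ρ κ D a) := by
      -- The cycle through the first point never leaves the `ρ`-orbit of `a`: there `σ` is still the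
      -- directed rotation.
      have hcl : ∀ i : ℕ, SameCycle ρ a ((σ ^ i) (fst ρ D a)) := by
        intro i
        induction i with
        | zero => exact sameCycle_fst D a
        | succ i ih =>
          rw [pow_succ', mul_apply]
          set z := (σ ^ i) (fst ρ D a)
          rw [h2 z]
          · simp only [dirPerm, coe_fn_mk]
            split_ifs
            · exact sameCycle_apply_right.2 ih
            · exact sameCycle_symm_apply_right.2 ih
          · intro b hb
            constructor
            · intro e
              apply haT
              rw [G.unique a haS b (hTS b hb) (ih.trans (e ▸ (sameCycle_fst D b).symm))]
              exact hb
            · intro e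
              have e1 := G.rank_eq (ih.trans (e ▸ (sameCycle_snd (κ := κ) D b).symm))
              have e2 := G.rank_lt b (hTS b hb)
              exact absurd (hmax b hb) (not_le.2 (e1 ▸ e2))
      intro h
      obtain ⟨i, hi⟩ := h.exists_nat_pow_eq
      have e1 := G.rank_eq ((hi ▸ hcl i).trans (sameCycle_snd (κ := κ) D a).symm)
      exact absurd (G.rank_lt a haS) (by rw [e1]; exact lt_irrefl _)
    have hst : ∀ b ∈ T, fst ρ D b ≠ fst ρ D a ∧ snd ρ κ D b ≠ snd ρ κ D a := by
      intro b hb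
      refine ⟨fun e => haT ?_, fun e => haT ?_⟩
      · rw [G.unique a haS b (hTS b hb)
          ((sameCycle_fst D a).trans (e ▸ (sameCycle_fst D b).symm))]
        exact hb
      · rw [← G.snd_injOn hD hκ (hTS b hb) haS e]
        exact hb
    refine ⟨σ * swap (fst ρ D a) (snd ρ κ D a), ?_, ?_, ?_, ?_⟩
    · intro b hb
      rw [Finset.mem_insert] at hb
      by_cases hba : b = a
      · subst hba
        rw [mul_apply, mul_apply, swap_apply_left, swap_apply_right]
        constructor
        · apply h2
          exact fun c hc => ⟨(G.fst_ne_snd hD hκ (hTS c hc) haS).symm, (hst c hc).2.symm⟩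
        · apply h2
          exact fun c hc => ⟨(hst c hc).1.symm, G.fst_ne_snd hD hκ haS (hTS c hc)⟩
      · have hb := hb.resolve_left hba
        rw [mul_apply, mul_apply,
          swap_apply_of_ne_of_ne (hst b hb).1 (G.fst_ne_snd hD hκ (hTS b hb) haS),
          swap_apply_of_ne_of_ne (G.fst_ne_snd hD hκ haS (hTS b hb)).symm (hst b hb).2]
        exact h1 b hb
    · intro x hx
      have hxa := hx a (by simp)
      rw [mul_apply, swap_apply_of_ne_of_ne hxa.1 hxa.2]
      exact h2 x fun b hb => hx b (by simp [hb])
    · exact fun x y hxy => SameCycle.mul_swap hnot (h3 x y hxy)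
    · intro b hb
      rw [Finset.mem_insert] at hb
      rcases hb with rfl | hb
      · have e1 := SameCycle.mul_swap hnot (h3 _ _ (sameCycle_fst D b))
        have e2 := SameCycle.mul_swap hnot (h3 _ _ (sameCycle_snd (κ := κ) D b))
        exact e1.trans ((SameCycle.mul_swap_self hnot).trans e2.symm)
      · exact SameCycle.mul_swap hnot (h4 b hb)

/-- If only the cycle of `v₀` has no source, then all cycles are glued into one. -/
theorem exists_glued [Fintype V] [DecidableEq V] (G : Gluing ρ κ S rank) {D : V → Bool}
    (hD : ∀ v, D (ρ v) = D v) (hκ : ∀ a ∈ S, D (κ a) = !D a) (v₀ : V)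
    (hroot : ∀ v, (∃ a ∈ S, SameCycle ρ a v) ∨ SameCycle ρ v v₀) : ∃ σ : Perm V,
      (∀ a ∈ S, σ (fst ρ D a) = dirPerm ρ D hD (snd ρ κ D a) ∧
        σ (snd ρ κ D a) = dirPerm ρ D hD (fst ρ D a)) ∧
      (∀ x, (∀ a ∈ S, x ≠ fst ρ D a ∧ x ≠ snd ρ κ D a) → σ x = dirPerm ρ D hD x) ∧
      ∀ v, SameCycle σ v₀ v := by
  classical
  obtain ⟨σ, h1, h2, h3, h4⟩ :=
    G.exists_glued_aux hD hκ (Finset.univ.filter (· ∈ S)) (by simp)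
  simp only [Finset.mem_filter, Finset.mem_univ, true_and] at h1 h2 h4
  refine ⟨σ, h1, h2, fun v => ?_⟩
  induction v using (wf rank).induction with
  | _ v ih =>
    rcases hroot v with ⟨a, ha, hav⟩ | h
    · have := ih (κ a) (by rw [← G.rank_eq hav]; exact G.rank_lt a ha)
      exact this.trans ((h4 a ha).symm.trans (h3 _ _ hav))
    · exact (h3 _ _ h).symm

end Gluing
end Equiv.Perm

/-! ### Hamilton cycles from cyclic permutations -/

theorem exists_walk_of_seq {V : Type*} {G : SimpleGraph V} {f : ℕ → V}
    (h : ∀ i, G.Adj (f i) (f (i + 1))) (j m : ℕ) :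
    ∃ p : G.Walk (f j) (f (j + m)),
      p.support = (List.range (m + 1)).map fun i => f (j + i) := by
  induction m with
  | zero => exact ⟨.nil, by simp⟩
  | succ m ih =>
    obtain ⟨p, hp⟩ := ih
    refine ⟨p.concat (h (j + m)), ?_⟩
    rw [SimpleGraph.Walk.support_concat, hp, List.range_succ (n := m + 1)]
    simp

/-- A permutation with a single cycle that maps vertices to neighbours gives a Hamilton cycle. -/
theorem exists_isHamiltonianCycle_of_perm {V : Type*} [Fintype V] [DecidableEq V]
    {G : SimpleGraph V} {σ : Equiv.Perm V} {v : V} (hσ : ∀ x, σ.SameCycle v x)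
    (hG : ∀ x, G.Adj x (σ x)) (hV : 3 ≤ Fintype.card V) :
    ∃ (N : ℕ) (C : G.Walk v v), 1 ≤ N ∧ C.IsHamiltonianCycle ∧
      C.support.dropLast = (List.range N).map (fun i => σ^[i] v) ∧ σ^[N] v = v ∧
      ∀ i, 0 < i → i < N → σ^[i] v ≠ v := by
  set N := Function.minimalPeriod σ v with hN
  have hper : v ∈ Function.periodicPts σ := σ.injective.mem_periodicPts v
  have hpos : 0 < N := Function.minimalPeriod_pos_of_mem_periodicPts hper
  have hback : σ^[N] v = v := Function.iterate_minimalPeriod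
  have hinj : Set.InjOn (fun i => σ^[i] v) (Set.Iio N) := Function.iterate_injOn_Iio_minimalPeriod
  have hsurj : ∀ x, ∃ i < N, σ^[i] v = x := by
    intro x
    obtain ⟨i, hi⟩ := (hσ x).exists_nat_pow_eq
    refine ⟨i % N, Nat.mod_lt _ hpos, ?_⟩
    rw [Function.iterate_mod_minimalPeriod_eq, ← hi, Equiv.Perm.iterate_eq_pow]
  have hcard : 3 ≤ N := by
    have : (Finset.univ : Finset V) ⊆ (Finset.range N).image fun i => σ^[i] v := by
      intro x _
      obtain ⟨i, hi, rfl⟩ := hsurj x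
      exact Finset.mem_image_of_mem _ (Finset.mem_range.2 hi)
    have := (Finset.card_le_card this).trans Finset.card_image_le
    rw [Finset.card_univ, Finset.card_range] at this
    omega
  have hadj : ∀ i, G.Adj (σ^[i] v) (σ^[i + 1] v) := by
    intro i
    rw [Function.iterate_succ_apply']
    exact hG _
  obtain ⟨M, hM⟩ : ∃ M, N = M + 1 := ⟨N - 1, by omega⟩
  clear_value N
  subst hM
  obtain ⟨p, hp⟩ := exists_walk_of_seq (f := fun i => σ^[i] v) hadj 1 M
  have hlast : (fun i => σ^[i] v) (1 + M) = v := by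
    simp only
    rw [Nat.add_comm, hback]
  let q : G.Walk (σ v) v := p.copy rfl hlast
  have hq : q.support = (List.range (M + 1)).map fun i => σ^[1 + i] v := by
    rw [← hp]
    exact SimpleGraph.Walk.support_copy _ _ _
  have hqlen : q.length = M := by
    have := congrArg List.length hq
    rw [SimpleGraph.Walk.length_support] at this
    simpa using this
  have hnd : q.support.Nodup := by
    rw [hq, List.nodup_map_iff_inj_on List.nodup_range]
    intro i hi j hj hij
    simp only [Nat.add_comm 1, Function.iterate_succ_apply'] at hij
    rw [List.mem_range] at hi hj
    exact hinj hi hj (σ.injective hij)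
  have hqp : q.IsPath := (SimpleGraph.Walk.isPath_def q).2 hnd
  refine ⟨M + 1, .cons (hG v) q, by omega, ?_, ?_, hback, ?_⟩
  · rw [SimpleGraph.Walk.isHamiltonianCycle_iff_isCycle_and_support_count_tail_eq_one,
      SimpleGraph.Walk.cons_isCycle_iff]
    refine ⟨⟨hqp, fun hmem => ?_⟩, fun x => ?_⟩
    -- A path containing an edge between its own end points consists of that edge, but this path has
    -- length at least two.
    · have := hqp.length_eq_one_of_mem_edges (by rwa [Sym2.eq_swap])
      omega
    · rw [SimpleGraph.Walk.support_cons, List.tail_cons]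
      refine List.count_eq_one_of_mem hnd ?_
      obtain ⟨i, hi, hx⟩ := hsurj (σ.symm x)
      rw [hq, List.mem_map]
      refine ⟨i, List.mem_range.2 hi, ?_⟩
      rw [Nat.add_comm, Function.iterate_succ_apply', hx, Equiv.apply_symm_apply]
  · rw [SimpleGraph.Walk.support_cons, hq, List.range_succ, List.map_append, List.map_singleton,
      List.dropLast_cons_of_ne_nil (by simp), List.dropLast_concat, ← List.range_succ,
      List.range_succ_eq_map, List.map_cons, List.map_map]
    congr 1
    exact List.map_congr_left fun i _ => by rw [Function.comp_apply, Nat.add_comm]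
  -- This absence of an early return makes the reappearance of the start vertex a correct test for
  -- halting.
  · intro i hi hiN h
    have := hinj (x₁ := i) (x₂ := 0) hiN hpos h
    omega

/-! ### Characteristic words of stable sets -/

/-- The admissible parameters. -/
class Admissible (n k s : ℕ) : Prop where
  one_le : 1 ≤ k
  two_le : 2 ≤ s
  lt : s * k + 1 ≤ n

theorem Admissible.s_lt (n k s : ℕ) [h : Admissible n k s] : s < n := by
  have h1 := h.one_le
  have h3 := h.lt
  have : s * 1 ≤ s * k := Nat.mul_le_mul_left s h1
  omega

theorem Admissible.s_pos (n k s : ℕ) [h : Admissible n k s] : 0 < s := by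
  have := h.two_le
  omega

/-- The characteristic word of `A`, repeated periodically. -/
def bit {n : ℕ} [NeZero n] (A : Finset (Fin n)) (i : ℕ) : ℕ := if Fin.ofNat n i ∈ A then 1 else 0

section bit
variable {n : ℕ} [NeZero n] (A : Finset (Fin n))

theorem bit_periodic (i : ℕ) : bit A (i + n) = bit A i := by
  have : Fin.ofNat n (i + n) = Fin.ofNat n i := by
    ext
    simp [Fin.ofNat]
  rw [bit, this, bit]

theorem bit_mod (i : ℕ) : bit A (i % n) = bit A i := periodic_mod (bit_periodic A) i

theorem bit_le_one (i : ℕ) : bit A i ≤ 1 := by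
  unfold bit
  split_ifs <;> omega

theorem bit_eq_zero_or_one (i : ℕ) : bit A i = 0 ∨ bit A i = 1 := by
  have := bit_le_one A i
  omega

theorem bit_eq_one_iff {i : ℕ} : bit A i = 1 ↔ Fin.ofNat n i ∈ A := by
  unfold bit
  split_ifs with h
  · exact ⟨fun _ => h, fun _ => rfl⟩
  · exact ⟨fun e => absurd e (by decide), fun e => absurd e h⟩

theorem ofNat_val (x : Fin n) : Fin.ofNat n x = x := by
  ext
  simp [Fin.ofNat, Nat.mod_eq_of_lt x.isLt]

theorem bit_val (x : Fin n) : bit A x = if x ∈ A then 1 else 0 := by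
  rw [bit, ofNat_val]

theorem subset_iff_bit {A B : Finset (Fin n)} : A ⊆ B ↔ ∀ i, bit A i = 1 → bit B i = 1 := by
  simp only [bit_eq_one_iff]
  refine ⟨fun h i hi => h hi, fun h x hx => ?_⟩
  have := h x
  rw [ofNat_val] at this
  exact this hx

variable {A} in
theorem bit_injective {B : Finset (Fin n)} (h : ∀ i, bit A i = bit B i) : A = B :=
  (subset_iff_bit.2 fun i hi => h i ▸ hi).antisymm (subset_iff_bit.2 fun i hi => h i ▸ hi)

variable {A} in
-- In the periodic word both distance conditions become one: each 1 is followed by at least `s - 1`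
-- zeros. The upper bound on `j - i` is the case of a gap that wraps around the end.
theorem isStable_iff {s : ℕ} (hsn : s ≤ n) :
    IsStable s A ↔ ∀ i d, bit A i = 1 → 0 < d → d < s → bit A (i + d) = 0 := by
  constructor
  · intro h i d hi hd hds
    by_contra h0
    have h1 : bit A (i + d) = 1 := (bit_eq_zero_or_one A _).resolve_left h0
    have hn : 0 < n := by omega
    rw [bit_eq_one_iff] at hi h1
    have e1 : (Fin.ofNat n i : ℕ) = i % n := rfl
    have e2 : (Fin.ofNat n (i + d) : ℕ) = (i + d) % n := rfl
    have hr := Nat.mod_lt i hn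
    have e3 : (i + d) % n = (i % n + d) % n := by rw [Nat.mod_add_mod]
    rcases Nat.lt_or_ge (i % n + d) n with hlt | hge
    · rw [e3, Nat.mod_eq_of_lt hlt] at e2
      have := h _ hi _ h1 (by rw [Fin.lt_def, e1, e2]; omega)
      rw [e1, e2] at this
      omega
    · rw [e3, Nat.mod_eq_sub_mod hge, Nat.mod_eq_of_lt (by omega)] at e2
      have := h _ h1 _ hi (by rw [Fin.lt_def, e1, e2]; omega)
      rw [e1, e2] at this
      omega
  · intro h i hi j hj hij
    have hi1 : bit A i = 1 := by rw [bit_val, if_pos hi]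
    have hj1 : bit A j = 1 := by rw [bit_val, if_pos hj]
    rw [Fin.lt_def] at hij
    have hjn := j.isLt
    constructor
    · by_contra hlt
      have := h i (j - i) hi1 (by omega) (by omega)
      rw [show (i : ℕ) + (j - i) = j by omega] at this
      omega
    · by_contra hlt
      have := h j (n - (j - i)) hj1 (by omega) (by omega)
      rw [show (j : ℕ) + (n - (j - i)) = i + n by omega, bit_periodic] at this
      omega

theorem bit_map (e : Equiv.Perm (Fin n)) (i : ℕ) :
    bit (A.map e.toEmbedding) i = bit A (e.symm (Fin.ofNat n i)) := by
  unfold bit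
  rw [ofNat_val]
  exact if_congr Finset.mem_map_equiv rfl rfl

theorem bit_map_addRight (i : ℕ) :
    bit (A.map (Equiv.addRight (1 : Fin n)).toEmbedding) (i + 1) = bit A i := by
  rw [bit_map, ← bit_mod A i]
  congr 1
  have : Fin.ofNat n (i + 1) = Fin.ofNat n i + 1 := by
    ext
    simp [Fin.ofNat, Fin.val_add]
  rw [this, Equiv.addRight_symm, Equiv.coe_addRight]
  simp only [add_neg_cancel_right]
  rfl

end bit

/-- A letter `1` of the word that is followed by more than `s - 1` letters `0`. -/
def IsBig (s : ℕ) (b : ℕ → ℕ) (i : ℕ) : Prop := b i = 1 ∧ b (i + s) = 0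

/-- The letter `1` at position `0` is followed by a large gap, and it is the last one but one with
this property in the lexicographically smallest rotation of the word. -/
def IsSource (n s : ℕ) (b : ℕ → ℕ) : Prop :=
  IsBig s b 0 ∧ ∃ y, 1 ≤ y ∧ y < n ∧ IsBig s b y ∧ (∀ z, 1 ≤ z → z < y → ¬ IsBig s b z) ∧
    IsMinWord (shiftWord (y + 1) b)

/-! ### Uniqueness of the source of an orbit -/

section words
variable {n : ℕ}

theorem eq_of_shift_eq {b b' : ℕ → ℕ} (hb : ∀ i, b (i + n) = b i)
    (hb' : ∀ i, b' (i + n) = b' i) (hn : 0 < n) {m m' : ℕ} (hm : m ≤ m')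
    (h : ∀ i, b (m + i) = b' (m' + i)) (i : ℕ) : b i = b' (m' - m + i) := by
  have hle : m ≤ n * m := Nat.le_mul_of_pos_left m hn
  rw [← periodic_mul hb m i, ← periodic_mul hb' m (m' - m + i)]
  have := h (i + n * m - m)
  rwa [show m + (i + n * m - m) = i + n * m by omega,
    show m' + (i + n * m - m) = m' - m + i + n * m by omega] at this

theorem IsMinWord.eq {b c : ℕ → ℕ} (hb : IsMinWord b) (hc : IsMinWord c) {i j : ℕ}
    (hbc : b = shiftWord i c) (hcb : c = shiftWord j b) : b = c := by
  have h1 := hb j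
  have h2 := hc i
  rw [← hcb] at h1
  rw [← hbc] at h2
  rw [lexLT_iff] at h1 h2
  exact toLex.injective (le_antisymm (not_lt.1 h1) (not_lt.1 h2))

/-- A shift is undone by completing it to a multiple of the period. -/
theorem exists_shift_back {b : ℕ → ℕ} (hb : ∀ i, b (i + n) = b i) (hn : 0 < n) (i j : ℕ) :
    ∃ m, shiftWord m (shiftWord i b) = shiftWord j b := by
  refine ⟨j + n * i - i, ?_⟩
  have hle : i ≤ n * i := Nat.le_mul_of_pos_left i hn
  funext t
  simp only [shiftWord]
  rw [show i + (j + n * i - i + t) = j + t + n * i by omega, periodic_mul hb]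

/-- Both words have the same smallest rotation, starting right behind their next big letters at `y`
and `y'`. If `y < y'`, the leading big letter of `b` occurs in `b'` strictly between `0` and `y'`,
which is impossible. Only the words are equal, as `j` may be a rotational symmetry. -/
theorem IsSource.unique {b : ℕ → ℕ} {s : ℕ} (hb : ∀ i, b (i + n) = b i) (hn : 0 < n) {j : ℕ}
    (h : IsSource n s b) (h' : IsSource n s (shiftWord j b)) : b = shiftWord j b := by
  set b' := shiftWord j b with hb'def
  have hb' : ∀ i, b' (i + n) = b' i := fun i => by
    simp only [hb'def, shiftWord]
    rw [← Nat.add_assoc, hb]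
  obtain ⟨h0, y, hy1, hyn, hy, hymin, hmin⟩ := h
  obtain ⟨h0', y', hy1', hyn', hy', hymin', hmin'⟩ := h'
  have heq : shiftWord (y + 1) b = shiftWord (y' + 1) b' := by
    obtain ⟨m, hm⟩ := exists_shift_back hb hn (y + 1) (j + (y' + 1))
    obtain ⟨m', hm'⟩ := exists_shift_back hb hn (j + (y' + 1)) (y + 1)
    rw [← shiftWord_shiftWord (y' + 1) j b, ← hb'def] at hm hm'
    exact hmin.eq hmin' hm'.symm hm.symm
  have heq' : ∀ i, b (y + 1 + i) = b' (y' + 1 + i) := fun i => congrFun heq i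
  rcases lt_trichotomy y y' with hlt | rfl | hlt
  · have e := eq_of_shift_eq hb hb' hn (by omega) heq'
    refine absurd ?_ (hymin' (y' - y) (by omega) (by omega))
    have e0 := e 0
    have es := e (0 + s)
    rw [show y' + 1 - (y + 1) + 0 = y' - y by omega] at e0
    rw [show y' + 1 - (y + 1) + (0 + s) = y' - y + s by omega] at es
    exact ⟨e0 ▸ h0.1, es ▸ h0.2⟩
  · funext i
    have := eq_of_shift_eq hb hb' hn le_rfl heq' i
    rwa [Nat.sub_self, Nat.zero_add] at this
  · have e := eq_of_shift_eq hb' hb hn (by omega) fun i => (heq' i).symm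
    refine absurd ?_ (hymin (y - y') (by omega) (by omega))
    have e0 := e 0
    have es := e (0 + s)
    rw [show y + 1 - (y' + 1) + 0 = y - y' by omega] at e0
    rw [show y + 1 - (y' + 1) + (0 + s) = y - y' + s by omega] at es
    exact ⟨e0 ▸ h0'.1, es ▸ h0'.2⟩

end words

theorem shiftWord_lexLT_of_zeros {b : ℕ → ℕ} {x a : ℕ} (ha : b a = 1) (hlt : ∀ t < a, b t = 0)
    (hx : ∀ t ≤ a, b (x + t) = 0) : LexLT (shiftWord x b) b :=
  ⟨a, fun t ht => by rw [shiftWord, hx t ht.le, hlt t ht], by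
    rw [shiftWord, hx a le_rfl, ha]; exact Nat.one_pos⟩

theorem start_lt (n k s : ℕ) [Admissible n k s] (j : Fin k) : (j : ℕ) * s < n := by
  have h1 := Admissible.lt (n := n) (k := k) (s := s)
  have : (j : ℕ) * s ≤ k * s := Nat.mul_le_mul_right s j.isLt.le
  rw [Nat.mul_comm k s] at this
  omega

/-! ### Rotations of stable sets and the existence of sources -/

section stable
variable {n k s : ℕ} [NeZero n]

/-- The characteristic word of a vertex. -/
abbrev word (X : StableSet n k s) : ℕ → ℕ := bit X.1

theorem word_injective {X Y : StableSet n k s} (h : ∀ i, word X i = word Y i) : X = Y :=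
  Subtype.ext (bit_injective h)

theorem word_periodic (X : StableSet n k s) (i : ℕ) : word X (i + n) = word X i :=
  bit_periodic X.1 i

theorem word_mod (X : StableSet n k s) (i : ℕ) : word X (i % n) = word X i :=
  bit_mod X.1 i

theorem exists_isMinWord_shift {b : ℕ → ℕ} (hb : ∀ i, b (i + n) = b i) :
    ∃ j, IsMinWord (shiftWord j b) ∧ ∀ i, toLex (shiftWord j b) ≤ toLex (shiftWord i b) := by
  have hn : 0 < n := NeZero.pos n
  obtain ⟨j, -, hj⟩ := Finset.exists_min_image (Finset.range n) (fun j => toLex (shiftWord j b))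
    ⟨0, Finset.mem_range.2 hn⟩
  have hall : ∀ i, toLex (shiftWord j b) ≤ toLex (shiftWord i b) := by
    intro i
    have := hj (i % n) (Finset.mem_range.2 (Nat.mod_lt _ hn))
    have e : shiftWord (i % n) b = shiftWord i b := by
      funext t
      simp only [shiftWord]
      rw [← periodic_mod hb (i % n + t), Nat.mod_add_mod, periodic_mod hb]
    rwa [e] at this
  refine ⟨j, fun i => ?_, hall⟩
  rw [shiftWord_shiftWord, lexLT_iff]
  exact not_lt.2 (hall _)

theorem isStable_map_addRight {s : ℕ} (hsn : s ≤ n) {A : Finset (Fin n)} :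
    IsStable s (A.map (Equiv.addRight (1 : Fin n)).toEmbedding) ↔ IsStable s A := by
  rw [isStable_iff hsn, isStable_iff hsn]
  constructor
  · intro h i d hi hd hds
    have := h (i + 1) d (by rwa [bit_map_addRight]) hd hds
    rwa [show i + 1 + d = i + d + 1 by omega, bit_map_addRight] at this
  · intro h i d hi hd hds
    have hn : 1 ≤ n := NeZero.one_le
    rw [← bit_periodic, show i + n = i + (n - 1) + 1 by omega, bit_map_addRight] at hi
    have := h _ d hi hd hds
    rw [← bit_periodic, show i + d + n = i + (n - 1) + d + 1 by omega, bit_map_addRight]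
    exact this

variable [Admissible n k s]

theorem word_stable (X : StableSet n k s) {i d : ℕ} (hi : word X i = 1) (hd : 0 < d)
    (hds : d < s) : word X (i + d) = 0 :=
  (isStable_iff (Admissible.s_lt n k s).le).1 X.2.2 i d hi hd hds

variable (n k s) in
/-- The rotation of the vertices by one position. -/
def rot : Equiv.Perm (StableSet n k s) :=
  (Equiv.finsetCongr (Equiv.addRight (1 : Fin n))).subtypeEquiv fun A => by
    rw [Equiv.finsetCongr_apply, Finset.card_map, isStable_map_addRight (Admissible.s_lt n k s).le]

theorem word_rot (X : StableSet n k s) (i : ℕ) : word (rot n k s X) (i + 1) = word X i :=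
  bit_map_addRight X.1 i

theorem word_rot_symm (X : StableSet n k s) (i : ℕ) :
    word ((rot n k s).symm X) i = word X (i + 1) := by
  rw [← word_rot, Equiv.apply_symm_apply]

theorem word_rot_pow (X : StableSet n k s) (j i : ℕ) :
    word ((rot n k s ^ j) X) (j + i) = word X i := by
  induction j generalizing i with
  | zero => simp
  | succ j ih =>
    rw [pow_succ', Equiv.Perm.mul_apply, show j + 1 + i = j + i + 1 by omega, word_rot, ih]

theorem word_rot_pow_symm (X : StableSet n k s) (j : ℕ) :
    word ((rot n k s ^ j).symm X) = shiftWord j (word X) := by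
  funext i
  rw [← word_rot_pow, Equiv.apply_symm_apply]
  rfl

theorem sameCycle_rot_iff {X Y : StableSet n k s} :
    (rot n k s).SameCycle X Y ↔ ∃ j, word X = shiftWord j (word Y) := by
  constructor
  · intro h
    obtain ⟨j, rfl⟩ := h.exists_nat_pow_eq
    exact ⟨j, funext fun i => (word_rot_pow X j i).symm⟩
  · rintro ⟨j, hj⟩
    refine ⟨j, ?_⟩
    rw [zpow_natCast]
    have : X = (rot n k s ^ j).symm Y := word_injective fun i => by rw [hj, word_rot_pow_symm]
    rw [this, Equiv.apply_symm_apply]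

theorem exists_word_eq_one (X : StableSet n k s) : ∃ i < n, word X i = 1 := by
  have : X.1.Nonempty := by
    rw [← Finset.card_pos, X.2.1]
    exact Admissible.one_le n s
  obtain ⟨x, hx⟩ := this
  exact ⟨x, x.isLt, by rw [word, bit_val, if_pos hx]⟩

/-- Otherwise each 1 is followed by another one at distance `s`, and the blocks of length `s` that
start at the `k` ones cover the whole cycle, so `n ≤ s * k`. -/
theorem exists_isBig (X : StableSet n k s) : ∃ i, IsBig s (word X) i := by
  by_contra hno
  simp only [not_exists] at hno
  have hs : 0 < s := Admissible.s_pos n k s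
  have hstep : ∀ i, word X i = 1 → word X (i + s) = 1 := fun i hi =>
    (bit_eq_zero_or_one X.1 (i + s)).resolve_left fun h => hno i ⟨hi, h⟩
  obtain ⟨i₀, hi₀n, hi₀⟩ := exists_word_eq_one X
  have hcov : ∀ t, ∃ i d, d < s ∧ i + d = i₀ + t ∧ word X i = 1 := by
    intro t
    induction t with
    | zero => exact ⟨i₀, 0, hs, rfl, hi₀⟩
    | succ t ih =>
      obtain ⟨i, d, hd, hid, hi⟩ := ih
      rcases Nat.lt_or_ge (d + 1) s with h | h
      · exact ⟨i, d + 1, h, by omega, hi⟩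
      · exact ⟨i + s, 0, hs, by omega, hstep i hi⟩
  have hsub : (Finset.univ : Finset (Fin n)) ⊆
      (X.1 ×ˢ Finset.range s).image fun p => Fin.ofNat n (p.1 + p.2) := by
    intro x _
    obtain ⟨i, d, hd, hid, hi⟩ := hcov (x + n - i₀)
    refine Finset.mem_image.2 ⟨(Fin.ofNat n i, d), ?_, ?_⟩
    · rw [Finset.mem_product, Finset.mem_range]
      exact ⟨(bit_eq_one_iff X.1).1 hi, hd⟩
    · ext
      have e : (Fin.ofNat n i : ℕ) = i % n := rfl
      have e' : i + d = x + n := by omega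
      simp only [Fin.ofNat] at e ⊢
      rw [Nat.mod_add_mod, e', Nat.add_mod_right, Nat.mod_eq_of_lt x.isLt]
  have := (Finset.card_le_card hsub).trans Finset.card_image_le
  rw [Finset.card_univ, Fintype.card_fin, Finset.card_product, Finset.card_range, X.2.1,
    Nat.mul_comm] at this
  have := Admissible.lt (n := n) (k := k) (s := s)
  omega

variable (n k s) in
/-- The elements of the vertex `{0, s, …, (k - 1) * s}`. -/
def startEmbedding : Fin k ↪ Fin n where
  toFun j := ⟨j * s, start_lt n k s j⟩
  inj' := by
    intro i j h
    ext
    exact Nat.eq_of_mul_eq_mul_right (Admissible.s_pos n k s) (Fin.mk.inj_iff.1 h)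

variable (n k s) in
/-- The vertex `{0, s, …, (k - 1) * s}`. -/
def start : StableSet n k s where
  val := Finset.univ.map (startEmbedding n k s)
  property := by
    refine ⟨by rw [Finset.card_map, Finset.card_univ, Fintype.card_fin], ?_⟩
    intro i hi j hj hij
    simp only [Finset.mem_map, Finset.mem_univ, true_and] at hi hj
    obtain ⟨x, rfl⟩ := hi
    obtain ⟨y, rfl⟩ := hj
    change (x : ℕ) * s < y * s at hij
    change s ≤ (y : ℕ) * s - x * s ∧ (y : ℕ) * s - x * s + s ≤ n
    have hxy : (x : ℕ) < y := lt_of_mul_lt_mul_right hij (Nat.zero_le s)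
    have h1 : ((x : ℕ) + 1) * s ≤ y * s := Nat.mul_le_mul_right s hxy
    have h2 : ((y : ℕ) + 1) * s ≤ k * s := Nat.mul_le_mul_right s y.isLt
    rw [Nat.add_mul, Nat.one_mul] at h1 h2
    have h3 := Admissible.lt (n := n) (k := k) (s := s)
    rw [Nat.mul_comm k s] at h2
    omega

theorem word_start {i : ℕ} (hi : i < n) :
    word (start n k s) i = 1 ↔ ∃ j < k, i = j * s := by
  have e : (Fin.ofNat n i) = ⟨i, hi⟩ := by ext; simp [Fin.ofNat, Nat.mod_eq_of_lt hi]
  rw [bit_eq_one_iff, e]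
  simp only [start, Finset.mem_map, Finset.mem_univ, true_and]
  exact ⟨fun ⟨j, hj⟩ => ⟨j, j.isLt, (Fin.mk.inj_iff.1 hj).symm⟩,
    fun ⟨j, hj, h⟩ => ⟨⟨j, hj⟩, Fin.ext h.symm⟩⟩

/-- Of a vertex whose word is a lexicographically smallest rotation, the last element is `n`, and
a gap of more than `s` follows. -/
theorem isBig_last (Y : StableSet n k s) (hY : IsMinWord (word Y)) :
    (∀ t < s, word Y t = 0) ∧ IsBig s (word Y) (n - 1) := by
  classical
  have hs : 2 ≤ s := Admissible.two_le n k
  have hn : s < n := Admissible.s_lt n k s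
  have hex : ∃ i, word Y i = 1 := (exists_word_eq_one Y).imp fun _ h => h.2
  set a := Nat.find hex with hadef
  have ha : word Y a = 1 := Nat.find_spec hex
  have hlt : ∀ t < a, word Y t = 0 := fun t ht =>
    (bit_eq_zero_or_one Y.1 t).resolve_right (Nat.find_min hex ht)
  -- With fewer than `s` leading zeros, the rotation that starts just behind a big 1 would have more
  -- of them and be smaller.
  have hsa : s ≤ a := by
    by_contra has
    obtain ⟨x, hx⟩ := exists_isBig Y
    refine hY (x + 1) (shiftWord_lexLT_of_zeros ha hlt fun t ht => ?_)
    rcases Nat.lt_or_ge (1 + t) s with h | h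
    · rw [Nat.add_assoc]
      exact word_stable Y hx.1 (by omega) h
    · rw [show x + 1 + t = x + s by omega]
      exact hx.2
  have hzero : ∀ t < s, word Y t = 0 := fun t ht => hlt t (by omega)
  refine ⟨hzero, ?_, ?_⟩
  · by_contra h1
    have h0 := (bit_eq_zero_or_one Y.1 (n - 1)).resolve_right h1
    -- A final 0 moved to the front would add a leading zero.
    refine hY (n - 1) (shiftWord_lexLT_of_zeros ha hlt fun t ht => ?_)
    rcases Nat.eq_zero_or_pos t with rfl | ht0
    · exact h0
    · rw [show n - 1 + t = t - 1 + n by omega, word_periodic]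
      exact hlt _ (by omega)
  · rw [show n - 1 + s = s - 1 + n by omega, word_periodic]
    exact hzero _ (by omega)

/-- A vertex all of whose gaps but one have size `s` is a rotation of the start vertex. -/
theorem sameCycle_start_of_tight (Y : StableSet n k s) (hz : ∀ t < s, word Y t = 0)
    (hY : ∀ p < n - 1, ¬ IsBig s (word Y) p) : (rot n k s).SameCycle Y (start n k s) := by
  classical
  have hs : 2 ≤ s := Admissible.two_le n k
  have hex : ∃ i, word Y i = 1 := (exists_word_eq_one Y).imp fun _ h => h.2
  set f := Nat.find hex with hadef
  have hf : word Y f = 1 := Nat.find_spec hex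
  have hfn : f < n := by
    obtain ⟨i, hi, h⟩ := exists_word_eq_one Y
    exact lt_of_le_of_lt (Nat.find_min' hex h) hi
  have hflt : ∀ t, word Y t = 1 → f ≤ t := fun t ht => Nat.find_min' hex ht
  have hone : ∀ p < n - 1, word Y p = 1 → word Y (p + s) = 1 := fun p hp h =>
    (bit_eq_zero_or_one Y.1 _).resolve_left fun h0 => hY p hp ⟨h, h0⟩
  -- Beginning with the first 1, the ones follow at distance `s` without wrapping around: a step
  -- past the end would hit the first `s` letters, which are zeros.
  have hall : ∀ j < k, f + j * s < n ∧ ∀ i ≤ j, word Y (f + i * s) = 1 := by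
    intro j hj
    induction j with
    | zero =>
      refine ⟨by omega, fun i hi => ?_⟩
      rw [Nat.le_zero.1 hi, Nat.zero_mul, Nat.add_zero]
      exact hf
    | succ j ih =>
      obtain ⟨h1, h2⟩ := ih (by omega)
      rw [Nat.add_mul, Nat.one_mul, ← Nat.add_assoc]
      -- If the end were reached with fewer than `k` ones, the progression would contain all ones of
      -- the word, contradicting its cardinality.
      have hne : f + j * s < n - 1 := by
        by_contra hge
        have hsub : Y.1 ⊆ (Finset.range (j + 1)).image fun i => Fin.ofNat n (f + i * s) := by
          intro x hx
          have hx1 : word Y x = 1 := by rw [word, bit_val, if_pos hx]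
          have hfx := hflt x hx1
          have hxn := x.isLt
          have hdm := Nat.div_add_mod (x - f) s
          have hij : (x - f) / s ≤ j := by
            have hle : (x - f) / s * s ≤ j * s := by rw [Nat.mul_comm]; omega
            exact Nat.le_of_mul_le_mul_right hle (by omega)
          have hr : (x - f : ℕ) % s = 0 := by
            by_contra hr
            have hms := Nat.mod_lt (x - f : ℕ) (show 0 < s by omega)
            have := word_stable Y (h2 _ hij) (Nat.pos_of_ne_zero hr) hms
            rw [Nat.mul_comm, show f + s * ((x - f : ℕ) / s) + (x - f : ℕ) % s = x by omega,
              hx1] at this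
            omega
          refine Finset.mem_image.2 ⟨(x - f : ℕ) / s, by rw [Finset.mem_range]; omega, ?_⟩
          rw [Nat.mul_comm, show f + s * ((x - f : ℕ) / s) = x by omega, ofNat_val]
        have := (Finset.card_le_card hsub).trans Finset.card_image_le
        rw [Y.2.1, Finset.card_range] at this
        omega
      have h3 := hone _ hne (h2 j le_rfl)
      refine ⟨?_, fun i hi => ?_⟩
      · by_contra hge
        have := hz (f + j * s + s - n) (by omega)
        rw [← word_periodic, show f + j * s + s - n + n = f + j * s + s by omega] at this
        omega
      · rcases Nat.lt_or_ge i (j + 1) with h | h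
        · exact h2 i (by omega)
        · rw [show i = j + 1 by omega, Nat.add_mul, Nat.one_mul, ← Nat.add_assoc]
          exact h3
  refine Equiv.Perm.SameCycle.symm ⟨f, ?_⟩
  rw [zpow_natCast]
  have hsub : (start n k s).1 ⊆ ((rot n k s ^ f).symm Y).1 := by
    rw [subset_iff_bit]
    intro i hi
    rw [← bit_mod, word_start (Nat.mod_lt _ (NeZero.pos n))] at hi
    obtain ⟨j, hj, hij⟩ := hi
    have : word ((rot n k s ^ f).symm Y) i = 1 := by
      rw [← word_mod, word_rot_pow_symm, hij]
      exact (hall j hj).2 j le_rfl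
    exact this
  have heq : start n k s = (rot n k s ^ f).symm Y :=
    Subtype.ext (Finset.eq_of_subset_of_card_le hsub
      (by rw [((rot n k s ^ f).symm Y).2.1, (start n k s).2.1]))
  rw [heq, Equiv.apply_symm_apply]

/-- Every rotation orbit other than that of the start vertex has a source. -/
theorem exists_source (X : StableSet n k s) :
    (∃ a ∈ {a : StableSet n k s | IsSource n s (word a)}, (rot n k s).SameCycle a X) ∨
      (rot n k s).SameCycle X (start n k s) := by
  classical
  have hs : 2 ≤ s := Admissible.two_le n k
  have hn : s < n := Admissible.s_lt n k s
  obtain ⟨j, hj, -⟩ := exists_isMinWord_shift (word_periodic X)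
  set Y := (rot n k s ^ j).symm X with hYdef
  have hYX : (rot n k s).SameCycle Y X := sameCycle_rot_iff.2 ⟨j, word_rot_pow_symm X j⟩
  rw [← word_rot_pow_symm X j, ← hYdef] at hj
  obtain ⟨hz, hlast⟩ := isBig_last Y hj
  by_cases hbig : ∃ p < n - 1, IsBig s (word Y) p
  · left
    obtain ⟨p₀, hp₀, hp₀b⟩ := hbig
    -- The last big 1 before the final one becomes the beginning of the source.
    obtain ⟨p, hp, hpmax⟩ := Finset.exists_max_image
      ((Finset.range (n - 1)).filter fun p => IsBig s (word Y) p) id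
      ⟨p₀, by rw [Finset.mem_filter, Finset.mem_range]; exact ⟨hp₀, hp₀b⟩⟩
    rw [Finset.mem_filter, Finset.mem_range] at hp
    have hshift : ∀ i, IsBig s (shiftWord p (word Y)) i ↔ IsBig s (word Y) (p + i) := fun i => by
      simp only [IsBig, shiftWord, Nat.add_assoc]
    refine ⟨(rot n k s ^ p).symm Y, ?_,
      (sameCycle_rot_iff.2 ⟨p, word_rot_pow_symm Y p⟩).trans hYX⟩
    rw [Set.mem_ofPred_eq, word_rot_pow_symm]
    refine ⟨(hshift 0).2 hp.2, n - 1 - p, by omega, by omega, (hshift _).2 ?_, ?_, ?_⟩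
    · rw [show p + (n - 1 - p) = n - 1 by omega]
      exact hlast
    · intro z hz1 hz2 hzb
      have := hpmax (p + z) (by
        rw [Finset.mem_filter, Finset.mem_range]
        exact ⟨by omega, (hshift z).1 hzb⟩)
      simp only [id] at this
      omega
    · rw [shiftWord_shiftWord, show p + (n - 1 - p + 1) = n by omega]
      have : shiftWord n (word Y) = word Y := funext fun i => by
        rw [shiftWord, Nat.add_comm, word_periodic]
      rw [this]
      exact hj
  · right
    simp only [not_exists, not_and] at hbig
    exact hYX.symm.trans (sameCycle_start_of_tight Y hz hbig)

end stable

/-! ### Swapping the first two letters -/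

/-- The image of a set under the exchange of the two smallest elements of the ground set. -/
def swapSet {n : ℕ} [NeZero n] (A : Finset (Fin n)) : Finset (Fin n) :=
  A.map (Equiv.swap (0 : Fin n) (Fin.ofNat n 1)).toEmbedding

section swap
variable {n : ℕ} [NeZero n]

theorem swapSet_swapSet (A : Finset (Fin n)) : swapSet (swapSet A) = A := by
  unfold swapSet
  rw [Finset.map_map]
  ext x
  simp [Finset.mem_map]

theorem card_swapSet (A : Finset (Fin n)) : (swapSet A).card = A.card := Finset.card_map _

theorem bit_swapSet (hn : 1 < n) (A : Finset (Fin n)) {i : ℕ} (hi : i < n) :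
    bit (swapSet A) i = if i = 0 then bit A 1 else if i = 1 then bit A 0 else bit A i := by
  have hv : ∀ j : ℕ, j < n → (Fin.ofNat n j : ℕ) = j := fun j hj => Nat.mod_eq_of_lt hj
  have h1 := hv 1 hn
  unfold swapSet
  rw [bit_map, Equiv.symm_swap]
  by_cases h0 : i = 0
  · subst h0
    rw [if_pos rfl, show Fin.ofNat n 0 = 0 from rfl, Equiv.swap_apply_left, h1]
  rw [if_neg h0]
  by_cases hi1 : i = 1
  · subst hi1
    rw [if_pos rfl, Equiv.swap_apply_right]
    rfl
  rw [if_neg hi1, Equiv.swap_apply_of_ne_of_ne, hv i hi]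
  · intro e
    have := congrArg Fin.val e
    rw [hv i hi] at this
    exact h0 this
  · intro e
    have := congrArg Fin.val e
    rw [hv i hi, h1] at this
    exact hi1 this

/-- Zeros at `2, …, s` and at the last `s - 1` positions leave room for a 1 at either of the first
two positions, so this serves for moves in both directions. -/
theorem isStable_swapSet {A : Finset (Fin n)} {s : ℕ} (hs : 2 ≤ s) (hsn : s < n)
    (hA : IsStable s A) (h1 : ∀ i, 2 ≤ i → i ≤ s → bit A i = 0)
    (h2 : ∀ i, n < i + s → i < n → bit A i = 0) : IsStable s (swapSet A) := by
  rw [isStable_iff hsn.le] at hA ⊢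
  have hsw := fun i => bit_swapSet (show 1 < n by omega) A (i := i)
  intro i d hi hd hds
  rw [← bit_mod] at hi ⊢
  have hin := Nat.mod_lt i (show 0 < n by omega)
  rw [← Nat.mod_add_mod]
  generalize i % n = r at *
  have h01 : bit A 0 = 1 → bit A 1 = 0 := fun h => hA 0 1 h (by omega) (by omega)
  have hlow : ∀ j, 2 ≤ j → j ≤ s → bit (swapSet A) (j % n) = 0 := fun j hj hjs => by
    rw [Nat.mod_eq_of_lt (by omega), hsw j (by omega), if_neg (by omega), if_neg (by omega)]
    exact h1 j hj hjs
  rw [hsw r hin] at hi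
  by_cases hr0 : r = 0
  · subst hr0
    rw [if_pos rfl] at hi
    rcases Nat.lt_or_ge d 2 with hd2 | hd2
    · rw [Nat.mod_eq_of_lt (by omega), hsw _ (by omega), if_neg (by omega), if_pos (by omega)]
      rcases bit_eq_zero_or_one A 0 with h | h
      · exact h
      · have := h01 h
        omega
    · exact hlow _ (by omega) (by omega)
  rw [if_neg hr0] at hi
  by_cases hr1 : r = 1
  · exact hlow _ (by omega) (by omega)
  rw [if_neg hr1] at hi
  have hrs : s < r := by
    by_contra h
    have := h1 r (by omega) (by omega)
    omega
  have hrn : r + s ≤ n := by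
    by_contra h
    have := h2 r (by omega) hin
    omega
  rw [Nat.mod_eq_of_lt (by omega), hsw _ (by omega), if_neg (by omega), if_neg (by omega)]
  exact hA r d hi hd hds

variable {k s : ℕ}

open Classical in
/-- The exchange of the two smallest elements of the ground set, where it preserves stability. -/
noncomputable def swapFirst (X : StableSet n k s) : StableSet n k s :=
  if h : IsStable s (swapSet X.1) then ⟨swapSet X.1, by rw [card_swapSet]; exact X.2.1, h⟩ else X

theorem swapFirst_val {X : StableSet n k s} (h : IsStable s (swapSet X.1)) :
    (swapFirst X).1 = swapSet X.1 := by
  rw [swapFirst, dif_pos h]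

/-- The default value `X` makes the exchange a total involution, so injectivity needs no hypothesis
of stability. -/
theorem swapFirst_swapFirst (X : StableSet n k s) : swapFirst (swapFirst X) = X := by
  by_cases h : IsStable s (swapSet X.1)
  · have h1 := swapFirst_val h
    apply Subtype.ext
    rw [swapFirst_val, h1, swapSet_swapSet]
    rw [h1, swapSet_swapSet]
    exact X.2.2
  · have : swapFirst X = X := by rw [swapFirst, dif_neg h]
    rw [this, this]

variable (n k s) in
/-- The smallest rotation of the characteristic word of a vertex. -/
noncomputable def minRot (X : StableSet n k s) : Lex (ℕ → ℕ) :=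
  toLex (shiftWord (exists_isMinWord_shift (word_periodic X)).choose (word X))

theorem minRot_le (X : StableSet n k s) (i : ℕ) :
    minRot n k s X ≤ toLex (shiftWord i (word X)) :=
  (exists_isMinWord_shift (word_periodic X)).choose_spec.2 i

theorem minRot_eq {X : StableSet n k s} {j : ℕ} (h : IsMinWord (shiftWord j (word X))) :
    minRot n k s X = toLex (shiftWord j (word X)) := by
  refine le_antisymm (minRot_le X j) ?_
  obtain ⟨m, hm⟩ := exists_shift_back (word_periodic X) (NeZero.pos n) j
    (exists_isMinWord_shift (word_periodic X)).choose
  have := h m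
  rw [hm, lexLT_iff] at this
  exact not_lt.1 this

theorem word_eq_zero_of_adj {X Y : StableSet n k s} (h : (stableKneserGraph n k s).Adj X Y)
    {i : ℕ} (hi : word X i = 1) : word Y i = 0 := by
  refine (bit_eq_zero_or_one Y.1 i).resolve_right fun h1 => ?_
  exact Finset.disjoint_left.1 h.2 ((bit_eq_one_iff _).1 hi) ((bit_eq_one_iff _).1 h1)

variable [Admissible n k s]

theorem word_swapFirst {X : StableSet n k s} (h : IsStable s (swapSet X.1)) {i : ℕ} (hi : i < n) :
    word (swapFirst X) i =
      if i = 0 then word X 1 else if i = 1 then word X 0 else word X i := by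
  have h1 := Admissible.two_le n k (s := s)
  have h2 := Admissible.s_lt n k s
  rw [word, swapFirst_val h]
  exact bit_swapSet (by omega) X.1 hi

theorem isStable_swapSet_of_isBig {X : StableSet n k s} (h : IsBig s (word X) 0) :
    IsStable s (swapSet X.1) := by
  have hs := Admissible.two_le n k (s := s)
  refine isStable_swapSet hs (Admissible.s_lt n k s) X.2.2 (fun i hi his => ?_)
    fun i hi hin => ?_
  · rcases Nat.lt_or_ge i s with hlt | hge
    · have := word_stable X h.1 (d := i) (by omega) hlt
      rwa [Nat.zero_add] at this
    · obtain rfl : i = s := by omega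
      have := h.2
      rwa [Nat.zero_add] at this
  · refine (bit_eq_zero_or_one X.1 i).resolve_right fun h1 => ?_
    have h2 := word_stable X h1 (d := n - i) (by omega) (by omega)
    have h3 := word_periodic X 0
    rw [show i + (n - i) = 0 + n by omega, h3, h.1] at h2
    omega

theorem isStable_swapSet_of_left {X : StableSet n k s} (h : word X 1 = 1)
    (h' : word X (n + 1 - s) = 0) : IsStable s (swapSet X.1) := by
  have hs := Admissible.two_le n k (s := s)
  refine isStable_swapSet hs (Admissible.s_lt n k s) X.2.2 (fun i hi his => ?_)
    fun i hi hin => ?_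
  · have := word_stable X h (d := i - 1) (by omega) (by omega)
    rwa [show 1 + (i - 1) = i by omega] at this
  · rcases Nat.lt_or_ge (n + 1 - s) i with hlt | hge
    · refine (bit_eq_zero_or_one X.1 i).resolve_right fun h1 => ?_
      have h2 := word_stable X h1 (d := n + 1 - i) (by omega) (by omega)
      have h3 := word_periodic X 1
      rw [show i + (n + 1 - i) = 1 + n by omega, h3, h] at h2
      omega
    · rwa [show n + 1 - s = i by omega] at h'

theorem word_one_of_isBig {X : StableSet n k s} (h : IsBig s (word X) 0) : word X 1 = 0 := by
  have hs := Admissible.two_le n k (s := s)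
  have := word_stable X h.1 (d := 1) (by omega) (by omega)
  rwa [Nat.zero_add] at this

theorem word_two_of_isBig {X : StableSet n k s} (h : IsBig s (word X) 0) : word X 2 = 0 := by
  have hs := Admissible.two_le n k (s := s)
  rcases Nat.lt_or_ge 2 s with hlt | hge
  · have := word_stable X h.1 (d := 2) (by omega) hlt
    rwa [Nat.zero_add] at this
  · obtain rfl : s = 2 := by omega
    exact h.2

variable (n k s) in
/-- The vertices at which the rotation orbits are glued to smaller ones. -/
def sources : Set (StableSet n k s) := {a | IsSource n s (word a)}

/-- The second big letter of a source lies beyond positions 1 and 2, which hold zeros. So for `n ≤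
3` the program may skip the gluings. -/
theorem three_lt_of_mem_sources {a : StableSet n k s} (ha : a ∈ sources n k s) : 3 < n := by
  obtain ⟨h0, y, hy1, hyn, hy, -⟩ := ha
  have hs := Admissible.two_le n k (s := s)
  by_contra hlt
  have hy2 : y = 1 ∨ y = 2 := by omega
  have h1 := word_one_of_isBig h0
  have h2 := word_two_of_isBig h0
  have h3 := hy.1
  rcases hy2 with rfl | rfl <;> omega

theorem minRot_rot (X : StableSet n k s) : minRot n k s (rot n k s X) = minRot n k s X := by
  obtain ⟨j, hj, -⟩ := exists_isMinWord_shift (word_periodic X)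
  have : shiftWord (j + 1) (word (rot n k s X)) = shiftWord j (word X) := by
    funext i
    simp only [shiftWord]
    rw [show j + 1 + i = j + i + 1 by omega]
    exact word_rot X _
  rw [minRot_eq hj, minRot_eq (j := j + 1), this]
  rw [this]
  exact hj

/-- In the smallest rotation, the leading 1 of `a` has index `n - (y + 1)`. The exchange turns it
into a 0 and changes no earlier letter, so already this rotation of the new word is smaller. -/
theorem minRot_swapFirst_lt {a : StableSet n k s} (ha : a ∈ sources n k s) :
    minRot n k s (swapFirst a) < minRot n k s a := by
  obtain ⟨h0, y, hy1, hyn, hy, -, hmin⟩ := ha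
  have hst := isStable_swapSet_of_isBig h0
  rw [minRot_eq hmin]
  refine lt_of_le_of_lt (minRot_le _ (y + 1)) (lexLT_iff.1 ?_)
  refine ⟨n - (y + 1), fun t ht => ?_, ?_⟩
  · simp only [shiftWord]
    exact (word_swapFirst hst (by omega)).trans
      (by rw [if_neg (by omega), if_neg (by omega)])
  · simp only [shiftWord]
    rw [show y + 1 + (n - (y + 1)) = 0 + n by omega, word_periodic, word_periodic]
    have h1 := word_swapFirst hst (NeZero.pos n)
    rw [if_pos rfl, word_one_of_isBig h0] at h1
    rw [h1, h0.1]
    exact Nat.one_pos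

theorem gluing : Equiv.Perm.Gluing (rot n k s) swapFirst (sources n k s) (minRot n k s) where
  rank_rot := minRot_rot
  rank_lt _ := minRot_swapFirst_lt
  unique a ha b hb h := by
    obtain ⟨j, hj⟩ := sameCycle_rot_iff.1 h.symm
    refine word_injective fun i => ?_
    have hb' : IsSource n s (shiftWord j (word a)) := hj ▸ hb
    rw [hj]
    exact congrFun (IsSource.unique (word_periodic a) (NeZero.pos n) ha hb') i
  inj a _ b _ h := by rw [← swapFirst_swapFirst a, h, swapFirst_swapFirst]
  -- Position 2 separates them: a source has a 0 there, and a rotated target a 1.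
  disj a ha b hb h := by
    have hs := Admissible.two_le n k (s := s)
    have hn := Admissible.s_lt n k s
    have h1 : word a 2 = word (swapFirst b) 1 := by rw [h]; exact word_rot _ 1
    rw [word_two_of_isBig ha.1, word_swapFirst (isStable_swapSet_of_isBig hb.1) (by omega),
      if_neg (by omega), if_pos rfl, hb.1.1] at h1
    omega

/-! ### The successor -/

theorem adj_of_word {X Y : StableSet n k s} (h : ∀ i, word X i = 1 → word Y i = 0) :
    (stableKneserGraph n k s).Adj X Y := by
  refine ⟨fun e => ?_, ?_⟩
  · obtain ⟨i, -, hi⟩ := exists_word_eq_one X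
    have := h i hi
    rw [← e, hi] at this
    omega
  · rw [Finset.disjoint_left]
    intro x hx hy
    have h1 : word X x = 1 := by rw [word, bit_val, if_pos hx]
    have h2 : word Y x = 1 := by rw [word, bit_val, if_pos hy]
    have := h x h1
    omega

theorem word_rot' (X : StableSet n k s) (i : ℕ) :
    word (rot n k s X) i = word X (i + (n - 1)) := by
  have hn := NeZero.pos n
  rw [← word_periodic, show i + n = i + (n - 1) + 1 by omega, word_rot]

theorem adj_rot (X : StableSet n k s) : (stableKneserGraph n k s).Adj X (rot n k s X) := by
  have hs := Admissible.two_le n k (s := s)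
  have hn := NeZero.pos n
  refine adj_of_word fun i hi => ?_
  rw [word_rot']
  refine (bit_eq_zero_or_one X.1 _).resolve_right fun h1 => ?_
  have := word_stable X h1 (d := 1) (by omega) (by omega)
  rw [show i + (n - 1) + 1 = i + n by omega, word_periodic, hi] at this
  omega

theorem adj_rot_rot {X Y : StableSet n k s} (h : (stableKneserGraph n k s).Adj X Y) :
    (stableKneserGraph n k s).Adj (rot n k s X) (rot n k s Y) := by
  refine adj_of_word fun i hi => ?_
  rw [word_rot'] at hi ⊢
  exact word_eq_zero_of_adj h hi

/-- The rotated target differs from `rot n k s a` only by a 1 moved from position 1 to position 2,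
where `a` has a 0 because its first letter is big. -/
theorem adj_rot_swapFirst {a : StableSet n k s} (ha : a ∈ sources n k s) :
    (stableKneserGraph n k s).Adj a (rot n k s (swapFirst a)) := by
  have hs := Admissible.two_le n k (s := s)
  have hn := Admissible.s_lt n k s
  refine adj_of_word fun i hi => ?_
  rw [word_rot', ← word_mod]
  have him := Nat.mod_lt (i + (n - 1)) (NeZero.pos n)
  set r := (i + (n - 1)) % n with hr
  have hi' : word a (r + 1) = 1 := by
    rw [← word_mod, hr, Nat.mod_add_mod, show i + (n - 1) + 1 = i + n by omega,
      Nat.add_mod_right, word_mod, hi]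
  rw [word_swapFirst (isStable_swapSet_of_isBig ha.1) him]
  split_ifs with h0 h1
  · exact word_one_of_isBig ha.1
  · have := word_two_of_isBig ha.1
    rw [h1] at hi'
    exact absurd (hi'.symm.trans this) (by omega)
  · refine (bit_eq_zero_or_one a.1 _).resolve_right fun h1 => ?_
    have := word_stable a h1 (d := 1) (by omega) (by omega)
    rw [hi'] at this
    omega

/-- The start word begins with a 1 and ends with two zeros, so its rotations by 0, 1 and 2 positions
differ. -/
theorem three_le_card [Fintype (StableSet n k s)] : 3 ≤ Fintype.card (StableSet n k s) := by
  have hs := Admissible.two_le n k (s := s)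
  have hn := Admissible.s_lt n k s
  have hlt := Admissible.lt (n := n) (k := k) (s := s)
  set X := start n k s
  have hX0 : word X 0 = 1 :=
    (word_start (NeZero.pos n)).2 ⟨0, Admissible.one_le n s, by omega⟩
  have hXn : ∀ d, 0 < d → d < 3 → word X (n - d) = 0 := by
    intro d hd hd3
    refine (bit_eq_zero_or_one X.1 _).resolve_right fun h1 => ?_
    obtain ⟨j, hj, hjs⟩ := (word_start (k := k) (s := s) (by omega)).1 h1
    have : (j + 1) * s ≤ k * s := Nat.mul_le_mul_right s hj
    rw [Nat.add_mul, Nat.one_mul, Nat.mul_comm k] at this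
    omega
  have h1 : X ≠ rot n k s X := (adj_rot X).1
  have h2 : X ≠ rot n k s (rot n k s X) := by
    intro e
    have h3 := word_periodic (rot n k s (rot n k s X)) 0
    rw [← e, hX0, e, show 0 + n = n - 2 + 1 + 1 by omega, word_rot, word_rot,
      hXn 2 (by omega) (by omega)] at h3
    omega
  refine Fintype.two_lt_card_iff.2 ⟨X, rot n k s X, rot n k s (rot n k s X), h1, h2, ?_⟩
  exact fun e => h1 ((rot n k s).injective e)

/-- The number of positions by which the gluing points are shifted in direction `D`. -/
def offset (D : Bool) : ℕ := if D then 0 else 1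

variable (n k s) in
/-- A Hamilton cycle of the graph as a permutation `σ`, with the direction `D` in which the
rotation orbits are traversed. -/
theorem exists_successor : ∃ (σ : Equiv.Perm (StableSet n k s)) (D : StableSet n k s → Bool),
    D (start n k s) = true ∧ (∀ X, σ.SameCycle (start n k s) X) ∧
    (∀ X, (stableKneserGraph n k s).Adj X (σ X)) ∧
    ∀ X, (∀ a ∈ sources n k s, X = (rot n k s ^ offset (D X)) a →
        σ X = (rot n k s ^ (offset (D X) + 1)) (swapFirst a) ∧ D (σ X) = !D X) ∧
      (∀ a ∈ sources n k s, X = (rot n k s ^ (offset (D X) + 1)) (swapFirst a) →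
        σ X = (rot n k s ^ offset (D X)) a ∧ D (σ X) = !D X) ∧
      ((∀ a ∈ sources n k s, X ≠ (rot n k s ^ offset (D X)) a ∧
        X ≠ (rot n k s ^ (offset (D X) + 1)) (swapFirst a)) →
        σ X = (if D X then rot n k s X else (rot n k s).symm X) ∧ D (σ X) = D X) := by
  classical
  have : Fintype (StableSet n k s) := Fintype.ofFinite _
  have G := gluing (n := n) (k := k) (s := s)
  obtain ⟨D, hD, hκ, hstart⟩ := G.exists_dir (start n k s)
  obtain ⟨σ, h1, h2, h3⟩ := G.exists_glued hD hκ (start n k s) exists_source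
  have hDsymm : ∀ v, D ((rot n k s).symm v) = D v := fun v => by
    rw [← hD, Equiv.apply_symm_apply]
  -- In direction `true` the gluing exchanges steps at `a` and `ρ (κ a)`, in direction `false` at
  -- their rotations by one; `offset` unifies both cases.
  have hA : ∀ X, ∀ a ∈ sources n k s, X = (rot n k s ^ offset (D X)) a →
      σ X = (rot n k s ^ (offset (D X) + 1)) (swapFirst a) ∧ D (σ X) = !D X := by
    intro X a ha hX
    have h := (h1 a ha).1
    have hDa := hκ a ha
    cases hDX : D X
    · simp only [hDX, offset, Bool.false_eq_true, if_false, pow_one] at hX ⊢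
      have hDa' : D a = false := by rw [← hD, ← hX, hDX]
      simp only [Equiv.Perm.Gluing.fst, Equiv.Perm.Gluing.snd, Equiv.Perm.dirPerm, hDa', hD, hDa,
        Equiv.coe_fn_mk, Bool.false_eq_true, if_false, Bool.not_false, if_true, ← hX] at h
      simp only [h, pow_succ, pow_zero, one_mul, Equiv.Perm.mul_apply, hD, hDa, hDa',
        Bool.not_false, and_self]
    · simp only [hDX, offset, if_true, pow_zero, zero_add, Equiv.Perm.one_apply] at hX ⊢
      subst hX
      simp only [Equiv.Perm.Gluing.fst, Equiv.Perm.Gluing.snd, Equiv.Perm.dirPerm, hDX, hD, hDa,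
        Equiv.coe_fn_mk, Bool.false_eq_true, if_false, Bool.not_true, if_true,
        Equiv.symm_apply_apply] at h
      simp only [h, pow_one, hD, hDa, hDX, Bool.not_true, and_self]
  have hB : ∀ X, ∀ a ∈ sources n k s, X = (rot n k s ^ (offset (D X) + 1)) (swapFirst a) →
      σ X = (rot n k s ^ offset (D X)) a ∧ D (σ X) = !D X := by
    intro X a ha hX
    have h := (h1 a ha).2
    have hDa := hκ a ha
    cases hDX : D X
    · simp only [hDX, offset, Bool.false_eq_true, if_false, pow_succ, pow_zero, one_mul,
        Equiv.Perm.mul_apply] at hX ⊢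
      have hDa' : D a = true := by
        have := hDX
        rw [hX, hD, hD, hDa] at this
        simpa using this
      simp only [Equiv.Perm.Gluing.fst, Equiv.Perm.Gluing.snd, Equiv.Perm.dirPerm, hDa',
        Equiv.coe_fn_mk, if_true, ← hX] at h
      simp only [h, hD, hDa', Bool.not_false, and_self]
    · simp only [hDX, offset, if_true, pow_zero, zero_add, pow_one, Equiv.Perm.one_apply] at hX ⊢
      have hDa' : D a = false := by
        have := hDX
        rw [hX, hD, hDa] at this
        simpa using this
      simp only [Equiv.Perm.Gluing.fst, Equiv.Perm.Gluing.snd, Equiv.Perm.dirPerm, hDa', hD,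
        Equiv.coe_fn_mk, Bool.false_eq_true, if_false, Equiv.symm_apply_apply, ← hX] at h
      simp only [h, hDa', Bool.not_true, and_self]
  have hC : ∀ X, (∀ a ∈ sources n k s, X ≠ (rot n k s ^ offset (D X)) a ∧
        X ≠ (rot n k s ^ (offset (D X) + 1)) (swapFirst a)) →
        σ X = (if D X then rot n k s X else (rot n k s).symm X) ∧ D (σ X) = D X := by
    intro X hX
    have h := h2 X fun a ha => by
      have hDa := hκ a ha
      have := hX a ha
      constructor
      · rintro rfl
        cases hDa' : D a <;>
          simp [Equiv.Perm.Gluing.fst, hDa', hD, offset] at this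
      · rintro rfl
        cases hDa' : D a <;>
          simp [Equiv.Perm.Gluing.snd, hDa', hD, hDa, offset, pow_succ] at this
    rw [h]
    refine ⟨rfl, ?_⟩
    simp only [Equiv.Perm.dirPerm, Equiv.coe_fn_mk]
    split_ifs
    · exact hD X
    · exact hDsymm X
  refine ⟨σ, D, hstart, h3, fun X => ?_, fun X => ⟨hA X, hB X, hC X⟩⟩
  -- Rotation preserves adjacency, so the pair `a`, `ρ (κ a)` yields all new edges.
  have hpow : ∀ j {Y Z : StableSet n k s}, (stableKneserGraph n k s).Adj Y Z →
      (stableKneserGraph n k s).Adj ((rot n k s ^ j) Y) ((rot n k s ^ j) Z) := by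
    intro j Y Z h
    induction j with
    | zero => exact h
    | succ j ih =>
      rw [pow_succ', Equiv.Perm.mul_apply, Equiv.Perm.mul_apply]
      exact adj_rot_rot ih
  by_cases hX : ∃ a ∈ sources n k s, X = (rot n k s ^ offset (D X)) a
  · obtain ⟨a, ha, hX⟩ := hX
    rw [(hA X a ha hX).1, pow_succ, Equiv.Perm.mul_apply]
    conv_lhs => rw [hX]
    exact hpow _ (adj_rot_swapFirst ha)
  by_cases hX' : ∃ a ∈ sources n k s, X = (rot n k s ^ (offset (D X) + 1)) (swapFirst a)
  · obtain ⟨a, ha, hX'⟩ := hX'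
    rw [(hB X a ha hX').1]
    conv_lhs => rw [hX']
    rw [pow_succ, Equiv.Perm.mul_apply]
    exact (hpow _ (adj_rot_swapFirst ha)).symm
  · rw [(hC X fun a ha => ⟨fun e => hX ⟨a, ha, e⟩, fun e => hX' ⟨a, ha, e⟩⟩).1]
    split_ifs
    · exact adj_rot X
    · have := adj_rot ((rot n k s).symm X)
      rw [Equiv.apply_symm_apply] at this
      exact this.symm

end swap

namespace WordRAM

/-! ### The program -/

infixr:60 " ⨟ " => Program.seq

/-- Extend the word in the cells `0, …, n - 1` periodically to the cells `0, …, 4 n - 1`. -/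
def extend : Program :=
  (.move 6 (.lit 0) ⨟ .plus 7 (.reg 0) (.reg 0) ⨟ .plus 7 (.reg 7) (.reg 0)) ⨟
  .loop (.lt (.reg 6) (.reg 7))
    (.load 14 (.reg 6) ⨟ .plus 13 (.reg 6) (.reg 0) ⨟ .store (.reg 13) (.reg 14) ⨟
      .plus 6 (.reg 6) (.lit 1))

/-- Register `10` gets the smallest position `y ≥ 1` of a large gap of the word that starts at the
cell given by register `8`, and `n` if there is none below `n`. -/
def scan : Program :=
  (.move 10 (.reg 0) ⨟ .minus 6 (.reg 0) (.lit 1)) ⨟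
  .loop (.lt (.lit 0) (.reg 6))
    (.plus 13 (.reg 8) (.reg 6) ⨟ .load 14 (.reg 13) ⨟
      .branch (.eq (.reg 14) (.lit 1))
        (.plus 13 (.reg 13) (.reg 2) ⨟ .load 14 (.reg 13) ⨟
          .branch (.eq (.reg 14) (.lit 0)) (.move 10 (.reg 6)) .skip)
        .skip ⨟
      .minus 6 (.reg 6) (.lit 1))

/-- Duval's algorithm for the word that starts behind position `10` of the word that starts at the
cell given by register `8`; register `12` gets `1` if no rotation is smaller, and `0` otherwise. -/
def duval : Program :=
  (.plus 16 (.reg 8) (.reg 10) ⨟ .plus 16 (.reg 16) (.lit 1) ⨟ .move 6 (.lit 1) ⨟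
    .move 11 (.lit 1) ⨟ .move 12 (.lit 1) ⨟ .plus 7 (.reg 0) (.reg 0)) ⨟
  .loop (.lt (.reg 6) (.reg 7))
    (.plus 13 (.reg 16) (.reg 6) ⨟ .load 14 (.reg 13) ⨟ .minus 13 (.reg 13) (.reg 11) ⨟
      .load 15 (.reg 13) ⨟
      -- A smaller letter refutes minimality for good: the loop continues, but register `12` is
      -- never reset.
      .branch (.lt (.reg 14) (.reg 15)) (.move 12 (.lit 0))
        (.branch (.lt (.reg 15) (.reg 14)) (.plus 11 (.reg 6) (.lit 1)) .skip) ⨟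
      .plus 6 (.reg 6) (.lit 1))

/-- Register `12` gets `1` if the word that starts at the cell given by register `8` is a source,
and `0` otherwise, provided that it starts with a large gap. -/
def sourceTest : Program :=
  scan ⨟ .branch (.lt (.reg 10) (.reg 0)) duval (.move 12 (.lit 0))

/-- Find out whether the current vertex may be a source (register `9` gets `1`) or a target (register
`9` gets `2`) of a gluing; register `8` gets the position of the gluing, and a possible target is
replaced by the corresponding source. -/
def classify : Program :=
  .move 9 (.lit 0) ⨟
  .branch (.lt (.lit 3) (.reg 0))
    (.load 14 (.reg 3) ⨟
      .branch (.eq (.reg 14) (.lit 1))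
        (.plus 13 (.reg 3) (.reg 2) ⨟ .load 14 (.reg 13) ⨟
          .branch (.eq (.reg 14) (.lit 0)) (.move 9 (.lit 1) ⨟ .move 8 (.reg 3)) .skip)
        (.plus 13 (.reg 3) (.lit 2) ⨟ .load 14 (.reg 13) ⨟
          .branch (.eq (.reg 14) (.lit 1))
            -- Adding `n` before subtracting `s` reaches the cell that is cyclically `s` places
            -- earlier, without truncation.
            (.plus 13 (.reg 13) (.reg 0) ⨟ .minus 13 (.reg 13) (.reg 2) ⨟ .load 14 (.reg 13) ⨟
              .branch (.eq (.reg 14) (.lit 0))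
                (.move 9 (.lit 2) ⨟ .plus 8 (.reg 3) (.lit 1) ⨟ .store (.reg 8) (.lit 1) ⨟
                  .plus 13 (.reg 8) (.lit 1) ⨟ .store (.reg 13) (.lit 0))
                .skip)
            .skip))
    .skip

/-- Replace the letters `10` at the position of the gluing by `01`. -/
def toTarget : Program :=
  .store (.reg 8) (.lit 0) ⨟ .plus 13 (.reg 8) (.lit 1) ⨟ .store (.reg 13) (.lit 1)

/-- Prepare the last rotation, by the distance in register `16`, and update the direction. -/
def prepare : Program :=
  .branch (.eq (.reg 12) (.lit 1))
    -- The target written in place of a source still needs one forward rotation, which reads at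
    -- distance `n - 1`; the source written in place of a target is one rotation too far and goes
    -- back, at distance 1.
    (.branch (.eq (.reg 9) (.lit 1)) (toTarget ⨟ .minus 16 (.reg 0) (.lit 1))
        (.move 16 (.lit 1)) ⨟
      .minus 3 (.lit 1) (.reg 3))
    (.branch (.eq (.reg 9) (.lit 2)) toTarget .skip ⨟
      .branch (.eq (.reg 3) (.lit 0)) (.minus 16 (.reg 0) (.lit 1)) (.move 16 (.lit 1)))

/-- Rotate by the distance in register `16`; register `4` gets `0` if the result is the start vertex,
which is stored from the cell given by register `5` on, and `1` otherwise. -/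
def rotate : Program :=
  (.move 4 (.lit 0) ⨟ .move 6 (.lit 0)) ⨟
  .loop (.lt (.reg 6) (.reg 0))
    (.plus 13 (.reg 6) (.reg 16) ⨟ .load 14 (.reg 13) ⨟ .plus 13 (.reg 5) (.reg 6) ⨟
      .load 15 (.reg 13) ⨟ .branch (.eq (.reg 14) (.reg 15)) .skip (.move 4 (.lit 1)) ⨟
      .store (.reg 6) (.reg 14) ⨟ .plus 6 (.reg 6) (.lit 1))

/-- Register `12` gets `1` if the current vertex is a source or a target of a gluing, and `0`
otherwise, when `classify` has been executed. -/
def isGlued : Program :=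
  .move 12 (.lit 0) ⨟ .branch (.eq (.reg 9) (.lit 0)) .skip (extend ⨟ sourceTest)

/-- Compute a rotation of the next vertex, the distance to it, and the new direction. -/
def glue : Program := extend ⨟ classify ⨟ isGlued ⨟ prepare

/-- Compute the next vertex. -/
def advance : Program := glue ⨟ extend ⨟ rotate

/-- Store the start vertex, twice. -/
def setUp : Program :=
  -- The reference copy starts at cell `5 n`, beyond the `4 n` cells used by `extend`.
  (.plus 5 (.reg 0) (.reg 0) ⨟ .plus 5 (.reg 5) (.reg 5) ⨟ .plus 5 (.reg 5) (.reg 0) ⨟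
    .move 4 (.lit 1) ⨟ .move 6 (.lit 0) ⨟ .move 7 (.lit 0)) ⨟
  .loop (.lt (.reg 6) (.reg 1))
    (.store (.reg 7) (.lit 1) ⨟ .plus 13 (.reg 5) (.reg 7) ⨟ .store (.reg 13) (.lit 1) ⨟
      .plus 7 (.reg 7) (.reg 2) ⨟ .plus 6 (.reg 6) (.lit 1))

/-- The program that computes a Hamilton cycle. -/
def hamiltonCycle : Program :=
  setUp ⨟ .loop (.eq (.reg 4) (.lit 1)) (.visit ⨟ advance)

end WordRAM

namespace WordRAM

/-! ### Verification of the loops -/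

/-- The registers outside of the list `l` agree. -/
def SameRegs (l : List ℕ) (σ τ : State) : Prop := ∀ r ∉ l, τ.reg r = σ.reg r

theorem SameRegs.rfl {l : List ℕ} {σ : State} : SameRegs l σ σ := fun _ _ => Eq.refl _

theorem SameRegs.update {l : List ℕ} {σ : State} {ρ m m' : ℕ → ℕ} {r v : ℕ}
    (h : SameRegs l σ ⟨ρ, m⟩) (hr : r ∈ l) : SameRegs l σ ⟨Function.update ρ r v, m'⟩ := by
  intro q hq
  have : q ≠ r := fun e => hq (e ▸ hr)
  exact (Function.update_of_ne this _ _).trans (h q hq)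

theorem Ends.ofWp {W N : ℕ} {P : Program} {σ : State} {Q : State → Prop} (h : P.wp W Q σ)
    (hN : P.cost ≤ N) : Ends W P σ N Q :=
  (P.wp_sound h).imp hN fun _ => id

theorem Ends.seqWp {W N N' : ℕ} {P P' : Program} {σ : State} {Q : State → Prop}
    (h : P.wp W (fun τ => Ends W P' τ N Q) σ) (hN : P.cost + N ≤ N') :
    Ends W (.seq P P') σ N' Q :=
  (Ends.seq (P.wp_sound h) fun _ => id).imp hN fun _ => id

theorem extend_spec {n : ℕ} (hn : 0 < n) {b : ℕ → ℕ} (hb : ∀ i, b (i + n) = b i)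
    (hb1 : ∀ i, b i ≤ 1) {σ : State} (h0 : σ.reg 0 = n) (hm : ∀ i < n, σ.mem i = b i) :
    Ends (1000 * n) extend σ (15 * n + 5) fun τ =>
      (∀ i < 4 * n, τ.mem i = b i) ∧ (∀ i, 4 * n ≤ i → τ.mem i = σ.mem i) ∧
      SameRegs [6, 7, 13, 14] σ τ := by
  let I : ℕ → State → Prop := fun m τ => m ≤ 3 * n ∧ τ.reg 6 = 3 * n - m ∧ τ.reg 7 = 3 * n ∧
    (∀ i < n + (3 * n - m), τ.mem i = b i) ∧ (∀ i, 4 * n ≤ i → τ.mem i = σ.mem i) ∧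
      SameRegs [6, 7, 13, 14] σ τ
  have hI0 : ∀ τ, I 0 τ → ¬ Test.Holds (.lt (.reg 6) (.reg 7)) τ := by
    rintro τ ⟨hm3, h6, h7, -⟩
    simp only [Test.Holds, Operand.val]
    omega
  refine Ends.seqWp (N := 3 * n * (4 + 1) + 1) ?_ (by simp only [Program.cost]; omega)
  simp [Program.wp, Operand.val, State.setReg, h0]
  refine ⟨by omega, by omega, by omega, (Ends.loop I ?_ hI0 (3 * n) _ ?_).imp le_rfl ?_⟩
  · rintro m τ ⟨hm3, h6, h7, hmem, hmem', hreg⟩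
    have hr0 := hreg 0 (by decide)
    have hv := hmem (3 * n - (m + 1)) (by omega)
    have hbv := hb1 (3 * n - (m + 1))
    refine ⟨by simp only [Test.Holds, Operand.val]; omega, Ends.ofWp ?_ (by decide)⟩
    obtain ⟨i, hi⟩ : ∃ i, i = 3 * n - (m + 1) := ⟨_, rfl⟩
    rw [← hi] at h6 hmem hv hbv
    simp [Program.wp, Operand.val, State.setReg, State.setMem, h6, hr0, h0, hv]
    refine ⟨by omega, by omega, by omega, by omega, by omega, ?_, h7, fun j hj => ?_,
      fun j hj => ?_, ?_⟩
    · simp only [Function.update_self]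
      omega
    · simp only [Function.update_apply]
      split_ifs with h
      · rw [h, hb]
      · exact hmem j (by omega)
    · simp only [Function.update_apply]
      rw [if_neg (by omega)]
      exact hmem' j hj
    · repeat refine SameRegs.update (m := τ.mem) ?_ (by decide)
      exact hreg
  · refine ⟨le_rfl, by simp, by simp only [Function.update_self]; omega, fun i hi => ?_,
      fun _ _ => rfl, ?_⟩
    · exact hm i (by omega)
    · repeat refine SameRegs.update (m := σ.mem) ?_ (by decide)
      exact SameRegs.rfl
  · rintro τ ⟨-, -, -, h1, h2, h3⟩
    exact ⟨fun i hi => h1 i (by omega), h2, h3⟩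

/-- The scan runs downwards, so the last position recorded is the smallest; the initial value `n`
means that none was found. -/
theorem scan_spec {n s e : ℕ} {b : ℕ → ℕ} (hn : 3 < n) (hs : s < n) (he : e ≤ 2)
    {σ : State} (h0 : σ.reg 0 = n) (h2 : σ.reg 2 = s) (h8 : σ.reg 8 = e)
    (hm : ∀ i < 4 * n, σ.mem i = b i) :
    Ends (1000 * n) scan σ (9 * n + 5) fun τ => τ.mem = σ.mem ∧ SameRegs [6, 10, 13, 14] σ τ ∧
      0 < τ.reg 10 ∧ τ.reg 10 ≤ n ∧ (τ.reg 10 < n → IsBig s (shiftWord e b) (τ.reg 10)) ∧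
        ∀ z, 0 < z → z < τ.reg 10 → ¬ IsBig s (shiftWord e b) z := by
  let I : ℕ → State → Prop := fun m τ => m < n ∧ τ.reg 6 = m ∧ τ.mem = σ.mem ∧
    SameRegs [6, 10, 13, 14] σ τ ∧
      ∃ y, τ.reg 10 = y ∧ m < y ∧ y ≤ n ∧ (y < n → IsBig s (shiftWord e b) y) ∧
        ∀ z, m < z → z < y → ¬ IsBig s (shiftWord e b) z
  have hI0 : ∀ τ, I 0 τ → ¬ Test.Holds (.lt (.lit 0) (.reg 6)) τ := by
    rintro τ ⟨-, h6, -⟩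
    simp only [Test.Holds, Operand.val]
    omega
  refine Ends.seqWp (N := (n - 1) * (8 + 1) + 1) ?_ (by simp only [Program.cost]; omega)
  simp [Program.wp, Operand.val, State.setReg, h0]
  refine ⟨by omega, by omega, (Ends.loop I ?_ hI0 (n - 1) _ ?_).imp le_rfl ?_⟩
  · rintro m τ ⟨hmn, h6, hmem, hreg, y, h10, hmy, hyn, hy, hmin⟩
    have hr2 := hreg 2 (by decide)
    have hr8 := hreg 8 (by decide)
    have hv := hm (e + (m + 1)) (by omega)
    have hv' := hm (e + (m + 1) + s) (by omega)
    rw [← hmem] at hv hv'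
    refine ⟨by simp only [Test.Holds, Operand.val]; omega, Ends.ofWp ?_ (by decide)⟩
    have hbig : IsBig s (shiftWord e b) (m + 1) ↔
        b (e + (m + 1)) = 1 ∧ b (e + (m + 1) + s) = 0 := by
      simp only [IsBig, shiftWord, Nat.add_assoc]
    simp [Program.wp, Operand.val, State.setReg, h6, hr2, h2, hr8, h8, hv, hv', Test.Holds]
    have hno : ¬ IsBig s (shiftWord e b) (m + 1) →
        ∀ z, m < z → z < y → ¬ IsBig s (shiftWord e b) z := by
      intro h z hz1 hz2
      rcases Nat.lt_or_ge (m + 1) z with hz | hz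
      · exact hmin z hz hz2
      · rwa [show z = m + 1 by omega]
    refine ⟨by omega, fun h1 => ⟨by omega, fun h2 => ⟨by omega, by omega, ?_⟩,
      fun h2 => ⟨by omega, ?_⟩⟩, fun h1 => ⟨by omega, ?_⟩⟩
    · refine ⟨by omega, by simp, hmem, ?_, m + 1, by simp, by omega, by omega,
        fun _ => hbig.2 ⟨h1, h2⟩, fun z hz1 hz2 => by omega⟩
      repeat refine SameRegs.update (m := τ.mem) ?_ (by decide)
      exact hreg
    · refine ⟨by omega, by simp, hmem, ?_, y, by simpa using h10, by omega, hyn, hy,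
        hno fun h => h2 (hbig.1 h).2⟩
      repeat refine SameRegs.update (m := τ.mem) ?_ (by decide)
      exact hreg
    · refine ⟨by omega, by simp, hmem, ?_, y, by simpa using h10, by omega, hyn, hy,
        hno fun h => h1 (hbig.1 h).1⟩
      repeat refine SameRegs.update (m := τ.mem) ?_ (by decide)
      exact hreg
  · refine ⟨by omega, by simp, rfl, ?_, n, by simp, by omega, le_rfl,
      fun h => absurd h (lt_irrefl _), fun z hz1 hz2 => by omega⟩
    repeat refine SameRegs.update (m := σ.mem) ?_ (by decide)
    exact SameRegs.rfl
  · rintro τ ⟨-, -, h1, h2, y, rfl, h3⟩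
    exact ⟨h1, h2, h3⟩

/-- The invariant is that of Duval's algorithm or a refutation already found; in the second case the
bounds on `p` remain only to keep the addresses valid. The reading starts at `n + 2` or earlier and
covers at most `2 n` letters, which fits into the periodic copy. -/
theorem duval_spec {n e y : ℕ} {b : ℕ → ℕ} (hn : 3 < n) (he : e ≤ 2) (hy : y < n)
    (hb : ∀ i, b (i + n) = b i)
    {σ : State} (h0 : σ.reg 0 = n) (h8 : σ.reg 8 = e) (h10 : σ.reg 10 = y)
    (hm : ∀ i < 4 * n, σ.mem i = b i) :
    Ends (1000 * n) duval σ (18 * n + 10) fun τ => τ.mem = σ.mem ∧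
      SameRegs [6, 7, 11, 12, 13, 14, 15, 16] σ τ ∧
      (τ.reg 12 = 1 ∧ IsMinWord (shiftWord (e + y + 1) b) ∨
        τ.reg 12 = 0 ∧ ¬ IsMinWord (shiftWord (e + y + 1) b)) := by
  obtain ⟨c, hc⟩ : ∃ c, c = shiftWord (e + y + 1) b := ⟨_, rfl⟩
  rw [← hc]
  let I : ℕ → State → Prop := fun m τ => m < 2 * n ∧ τ.reg 6 = 2 * n - m ∧ τ.reg 7 = 2 * n ∧
    τ.reg 16 = e + y + 1 ∧ τ.mem = σ.mem ∧ SameRegs [6, 7, 11, 12, 13, 14, 15, 16] σ τ ∧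
    ∃ p, τ.reg 11 = p ∧ 1 ≤ p ∧ p ≤ 2 * n - m ∧
      (τ.reg 12 = 1 ∧ DuvalInv c (2 * n - m) p ∨ τ.reg 12 = 0 ∧ ¬ IsMinWord c)
  have hI0 : ∀ τ, I 0 τ → ¬ Test.Holds (.lt (.reg 6) (.reg 7)) τ := by
    rintro τ ⟨-, h6, h7, -⟩
    simp only [Test.Holds, Operand.val]
    omega
  refine Ends.seqWp (N := (2 * n - 1) * (8 + 1) + 1) ?_ (by simp only [Program.cost]; omega)
  simp [Program.wp, Operand.val, State.setReg, h0, h8, h10]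
  refine ⟨by omega, by omega, by omega, by omega, (Ends.loop I ?_ hI0 (2 * n - 1) _ ?_).imp le_rfl ?_⟩
  · rintro m τ ⟨hmn, h6, h7, h16, hmem, hreg, p, h11, hp1, hpi, h12⟩
    obtain ⟨i, hi⟩ : ∃ i, i = 2 * n - (m + 1) := ⟨_, rfl⟩
    rw [← hi] at h6 hpi h12
    have hv := hm (e + y + 1 + i) (by omega)
    have hv' := hm (e + y + 1 + i - p) (by omega)
    rw [← hmem] at hv hv'
    refine ⟨by simp only [Test.Holds, Operand.val]; omega, Ends.ofWp ?_ (by decide)⟩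
    have hci : c i = b (e + y + 1 + i) := by rw [hc]; rfl
    have hcp : c (i - p) = b (e + y + 1 + i - p) := by
      rw [hc, shiftWord, show e + y + 1 + (i - p) = e + y + 1 + i - p by omega]
    rw [← hci] at hv
    rw [← hcp] at hv'
    simp [Program.wp, Operand.val, State.setReg, h6, h16, h11, hv, hv', Test.Holds]
    have him : 2 * n - m = i + 1 := by omega
    refine ⟨by omega, by omega, fun hlt => ⟨by omega, by omega, ?_⟩, fun hle =>
      ⟨fun hlt => ⟨by omega, ?_⟩, fun hge => ⟨by omega, ?_⟩⟩⟩
    · refine ⟨by omega, by simp [him], by simpa using h7, by simpa using h16, hmem, ?_, p,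
        by simpa using h11, hp1, by omega, Or.inr ⟨by simp, ?_⟩⟩
      · repeat refine SameRegs.update (m := τ.mem) ?_ (by decide)
        exact hreg
      · exact h12.elim (fun h => h.2.lt hlt) fun h => h.2
    · refine ⟨by omega, by simp [him], by simpa using h7, by simpa using h16, hmem, ?_, i + 1,
        by simp, by omega, by omega, ?_⟩
      · repeat refine SameRegs.update (m := τ.mem) ?_ (by decide)
        exact hreg
      · rw [him]
        exact h12.imp (fun h => ⟨by simpa using h.1, h.2.gt hlt⟩)
          fun h => ⟨by simpa using h.1, h.2⟩
    · refine ⟨by omega, by simp [him], by simpa using h7, by simpa using h16, hmem, ?_, p,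
        by simpa using h11, by omega, by omega, ?_⟩
      · repeat refine SameRegs.update (m := τ.mem) ?_ (by decide)
        exact hreg
      · rw [him]
        exact h12.imp (fun h => ⟨by simpa using h.1, h.2.eq (le_antisymm hge hle)⟩)
          fun h => ⟨by simpa using h.1, h.2⟩
  · have h1 : 2 * n - (2 * n - 1) = 1 := by omega
    refine ⟨by omega, by simp [h1], by simp only [Function.update_self]; omega, by simp, rfl, ?_,
      1, by simp, le_rfl, by omega, ?_⟩
    · repeat refine SameRegs.update (m := σ.mem) ?_ (by decide)
      exact SameRegs.rfl
    · rw [h1]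
      exact Or.inl ⟨by simp, duvalInv_one c⟩
  · rintro τ ⟨-, -, -, -, h1, h2, p, -, -, -, h3⟩
    refine ⟨h1, h2, h3.imp_left fun h => ⟨h.1, h.2.isMinWord (n := n) (by omega) fun i => ?_⟩⟩
    rw [hc, shiftWord, shiftWord, ← Nat.add_assoc, hb]

/-- Rotating in place is safe: every letter is read `off ≥ 1` cells ahead of the writing position,
and the periodic copy replaces wrapping around. -/
theorem rotate_spec {n off : ℕ} {b c : ℕ → ℕ} (hn : 1 < n) (hoff : 1 ≤ off) (hoffn : off < n)
    {σ : State} (h0 : σ.reg 0 = n) (h5 : σ.reg 5 = 5 * n) (h16 : σ.reg 16 = off)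
    (hb1 : ∀ i, b i ≤ 1) (hm : ∀ i < 4 * n, σ.mem i = b i)
    (hc : ∀ i < n, σ.mem (5 * n + i) = c i) :
    Ends (1000 * n) rotate σ (9 * n + 5) fun τ => (∀ i < n, τ.mem i = b (i + off)) ∧
      (∀ i < n, τ.mem (5 * n + i) = c i) ∧ SameRegs [4, 6, 13, 14, 15] σ τ ∧
      (τ.reg 4 = 0 ∧ (∀ i < n, b (i + off) = c i) ∨
        τ.reg 4 = 1 ∧ ∃ i < n, b (i + off) ≠ c i) := by
  let I : ℕ → State → Prop := fun m τ => m ≤ n ∧ τ.reg 6 = n - m ∧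
    (∀ i < n - m, τ.mem i = b (i + off)) ∧ (∀ i, n - m ≤ i → i < 4 * n → τ.mem i = b i) ∧
      (∀ i < n, τ.mem (5 * n + i) = c i) ∧ SameRegs [4, 6, 13, 14, 15] σ τ ∧
      (τ.reg 4 = 0 ∧ (∀ i < n - m, b (i + off) = c i) ∨
        τ.reg 4 = 1 ∧ ∃ i < n, b (i + off) ≠ c i)
  have hI0 : ∀ τ, I 0 τ → ¬ Test.Holds (.lt (.reg 6) (.reg 0)) τ := by
    rintro τ ⟨-, h6, -, -, -, hreg, -⟩
    have := hreg 0 (by decide)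
    simp only [Test.Holds, Operand.val]
    omega
  refine Ends.seqWp (N := n * (8 + 1) + 1) ?_ (by simp only [Program.cost]; omega)
  simp [Program.wp, Operand.val, State.setReg]
  refine ⟨by omega, (Ends.loop I ?_ hI0 n _ ?_).imp le_rfl ?_⟩
  · rintro m τ ⟨hmn, h6, h1, h2, h3, hreg, h4⟩
    obtain ⟨i, hi⟩ : ∃ i, i = n - (m + 1) := ⟨_, rfl⟩
    rw [← hi] at h6 h1 h2 h4
    have hr0 := hreg 0 (by decide)
    have hr5 := hreg 5 (by decide)
    have hr16 := hreg 16 (by decide)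
    have hv := h2 (i + off) (by omega) (by omega)
    have hv' := h3 i (by omega)
    have hv1 := hb1 (i + off)
    refine ⟨by simp only [Test.Holds, Operand.val]; omega, Ends.ofWp ?_ (by decide)⟩
    simp [Program.wp, Operand.val, State.setReg, State.setMem, h6, hr5, h5, hr16, h16, hv, hv',
      Test.Holds]
    have him : n - m = i + 1 := by omega
    have hmem₁ : ∀ j < i + 1, Function.update τ.mem i (b (i + off)) j = b (j + off) := by
      intro j hj
      rw [Function.update_apply]
      split_ifs with h
      · rw [h]
      · exact h1 j (by omega)
    have hmem₂ : ∀ j, i + 1 ≤ j → j < 4 * n → Function.update τ.mem i (b (i + off)) j = b j := by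
      intro j hj hjn
      rw [Function.update_of_ne (by omega)]
      exact h2 j (by omega) hjn
    have hmem₃ : ∀ j < n, Function.update τ.mem i (b (i + off)) (5 * n + j) = c j := by
      intro j hj
      rw [Function.update_of_ne (by omega)]
      exact h3 j hj
    refine ⟨by omega, by omega, fun heq => ⟨by omega, by omega, by omega, ?_⟩,
      fun hne => ⟨by omega, by omega, by omega, by omega, ?_⟩⟩
    · refine ⟨by omega, by simp [him], by rwa [him], by rwa [him], hmem₃, ?_, ?_⟩
      · repeat refine SameRegs.update (m := τ.mem) ?_ (by decide)
        exact hreg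
      · rw [him]
        refine h4.imp (fun h => ⟨by simpa using h.1, fun j hj => ?_⟩)
          fun h => ⟨by simpa using h.1, h.2⟩
        rcases Nat.lt_or_ge j i with hji | hji
        · exact h.2 j hji
        · rwa [show j = i by omega]
    · refine ⟨by omega, by simp [him], by rwa [him], by rwa [him], hmem₃, ?_,
        Or.inr ⟨by simp, i, by omega, hne⟩⟩
      repeat refine SameRegs.update (m := τ.mem) ?_ (by decide)
      exact hreg
  · refine ⟨le_rfl, by simp, fun i hi => by omega, fun i _ hi => hm i hi, hc, ?_,
      Or.inl ⟨by simp, fun i hi => by omega⟩⟩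
    repeat refine SameRegs.update (m := σ.mem) ?_ (by decide)
    exact SameRegs.rfl
  · rintro τ ⟨-, -, h1, -, h3, h4, h5⟩
    exact ⟨h1, h3, h4, h5⟩

end WordRAM

namespace WordRAM

/-! ### Verification of the successor computation -/

theorem sourceTest_spec {n s e : ℕ} {b : ℕ → ℕ} (hn : 3 < n) (hs : s < n) (he : e ≤ 2)
    (hb : ∀ i, b (i + n) = b i) (hbig : IsBig s (shiftWord e b) 0)
    {σ : State} (h0 : σ.reg 0 = n) (h2 : σ.reg 2 = s) (h8 : σ.reg 8 = e)
    (hm : ∀ i < 4 * n, σ.mem i = b i) :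
    Ends (1000 * n) sourceTest σ (27 * n + 16) fun τ => τ.mem = σ.mem ∧
      SameRegs [6, 7, 10, 11, 12, 13, 14, 15, 16] σ τ ∧
      (τ.reg 12 = 1 ∧ IsSource n s (shiftWord e b) ∨
        τ.reg 12 = 0 ∧ ¬ IsSource n s (shiftWord e b)) := by
  refine (Ends.seq (N := 9 * n + 5) (N' := 1 + (18 * n + 10))
    (scan_spec hn hs he h0 h2 h8 hm) ?_).imp (by omega) fun _ => id
  rintro τ ⟨hmem, hreg, hy0, hyn, hyb, hmin⟩
  have hr0 := hreg 0 (by decide)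
  have hr8 := hreg 8 (by decide)
  obtain ⟨y, hy⟩ : ∃ y, τ.reg 10 = y := ⟨_, rfl⟩
  rw [hy] at hy0 hyn hyb hmin
  have hsub : ∀ {τ' : State} {l : List ℕ}, (∀ r ∈ l, r ∈ [6, 7, 10, 11, 12, 13, 14, 15, 16]) →
      SameRegs l τ τ' → SameRegs [6, 7, 10, 11, 12, 13, 14, 15, 16] σ τ' := by
    intro τ' l hl h r hr
    rw [h r fun hrl => hr (hl r hrl)]
    refine hreg r fun h' => hr ?_
    revert h'
    simp only [List.mem_cons, List.not_mem_nil, or_false]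
    omega
  refine Ends.branch (fun hlt => ?_) (fun hge => ?_)
  · simp only [Test.Holds, Operand.val, hy, hr0, h0] at hlt
    refine (duval_spec hn he hlt hb (hr0.trans h0) (hr8.trans h8) hy (hmem ▸ hm)).imp le_rfl ?_
    rintro τ' ⟨hmem', hreg', h12⟩
    refine ⟨hmem'.trans hmem, hsub (by decide) hreg', h12.imp (fun h => ⟨h.1, ?_⟩)
      fun h => ⟨h.1, ?_⟩⟩
    · exact ⟨hbig, y, hy0, hlt, hyb hlt, hmin, by
        rw [shiftWord_shiftWord, ← Nat.add_assoc]; exact h.2⟩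
    -- A source can only be witnessed by the first big letter, which is the one found by the scan.
    · rintro ⟨-, y', hy0', hyn', hyb', hmin', hw⟩
      rcases lt_trichotomy y y' with h' | h' | h'
      · exact hmin' y hy0 h' (hyb hlt)
      · rw [shiftWord_shiftWord, ← Nat.add_assoc, ← h'] at hw
        exact h.2 hw
      · exact hmin y' hy0' h' hyb'
  · simp only [Test.Holds, Operand.val, hy, hr0, h0] at hge
    refine Ends.ofWp ?_ (by simp only [Program.cost]; omega)
    refine ⟨by simp only [Operand.val]; omega, hmem, ?_, Or.inr ⟨by
      simp [State.setReg, Operand.val], ?_⟩⟩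
    · exact hsub (l := [12]) (by decide) (SameRegs.update (m := τ.mem) SameRegs.rfl (by decide))
    · rintro ⟨-, y', hy0', hyn', hyb', hmin', hw⟩
      exact hmin y' hy0' (by omega) hyb'

theorem classify_spec {n s d : ℕ} (hn : 1 < n) (hs : s < n) (hd : d ≤ 1) {σ : State}
    (h0 : σ.reg 0 = n) (h2 : σ.reg 2 = s) (h3 : σ.reg 3 = d) :
    Ends (1000 * n) classify σ 20 fun τ => SameRegs [8, 9, 13, 14] σ τ ∧
      ((3 < n ∧ σ.mem d = 1 ∧ σ.mem (d + s) = 0 ∧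
          τ.reg 9 = 1 ∧ τ.reg 8 = d ∧ τ.mem = σ.mem) ∨
        (3 < n ∧ σ.mem d ≠ 1 ∧ σ.mem (d + 2) = 1 ∧ σ.mem (d + 2 + n - s) = 0 ∧
          τ.reg 9 = 2 ∧ τ.reg 8 = d + 1 ∧
          τ.mem = Function.update (Function.update σ.mem (d + 1) 1) (d + 2) 0) ∨
        (τ.reg 9 = 0 ∧ τ.mem = σ.mem ∧ (3 < n →
          (σ.mem d = 1 ∧ σ.mem (d + s) ≠ 0) ∨ (σ.mem d ≠ 1 ∧ σ.mem (d + 2) ≠ 1) ∨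
            (σ.mem d ≠ 1 ∧ σ.mem (d + 2 + n - s) ≠ 0)))) := by
  refine Ends.ofWp ?_ (by decide)
  by_cases hn3 : 3 < n
  · by_cases hv1 : σ.mem d = 1
    · by_cases hv2 : σ.mem (d + s) = 0
      · simp [classify, Program.wp, Operand.val, State.setReg, State.setMem, Test.Holds, h0, h2,
          h3, hn3, hv1, hv2]
        refine ⟨by omega, by omega, by omega, by omega, by omega, ?_⟩
        repeat refine SameRegs.update (m := σ.mem) ?_ (by decide)
        exact SameRegs.rfl
      · simp [classify, Program.wp, Operand.val, State.setReg, State.setMem, Test.Holds, h0, h2,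
          h3, hn3, hv1, hv2]
        refine ⟨by omega, by omega, by omega, ?_⟩
        repeat refine SameRegs.update (m := σ.mem) ?_ (by decide)
        exact SameRegs.rfl
    · by_cases hv3 : σ.mem (d + 2) = 1
      · by_cases hv4 : σ.mem (d + 2 + n - s) = 0
        · simp [classify, Program.wp, Operand.val, State.setReg, State.setMem, Test.Holds, h0, h2,
            h3, hn3, hv1, hv3, hv4]
          refine ⟨by omega, by omega, by omega, by omega, by omega, by omega, by omega, by omega,
            by omega, by omega, ?_⟩
          repeat refine SameRegs.update (m := σ.mem) ?_ (by decide)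
          exact SameRegs.rfl
        · simp [classify, Program.wp, Operand.val, State.setReg, State.setMem, Test.Holds, h0, h2,
            h3, hn3, hv1, hv3, hv4]
          refine ⟨by omega, by omega, by omega, by omega, by omega, ?_⟩
          repeat refine SameRegs.update (m := σ.mem) ?_ (by decide)
          exact SameRegs.rfl
      · simp [classify, Program.wp, Operand.val, State.setReg, State.setMem, Test.Holds, h0, h2,
          h3, hn3, hv1, hv3]
        refine ⟨by omega, by omega, by omega, ?_⟩
        repeat refine SameRegs.update (m := σ.mem) ?_ (by decide)
        exact SameRegs.rfl
  · simp [classify, Program.wp, Operand.val, State.setReg, State.setMem, Test.Holds, h0, hn3]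
    refine ⟨by omega, ?_⟩
    repeat refine SameRegs.update (m := σ.mem) ?_ (by decide)
    exact SameRegs.rfl

theorem prepare_spec {n d g o e : ℕ} (hn : 1 < n) (hd : d ≤ 1) (he : e ≤ 2) {σ : State}
    (h0 : σ.reg 0 = n) (h3 : σ.reg 3 = d) (h8 : (g = 1 ∨ g = 2) → σ.reg 8 = e) (h9 : σ.reg 9 = g)
    (h12 : σ.reg 12 = o) :
    Ends (1000 * n) prepare σ 10 fun τ => SameRegs [3, 13, 16] σ τ ∧
      τ.reg 3 = (if o = 1 then 1 - d else d) ∧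
      τ.reg 16 = (if (o = 1 ∧ g = 1) ∨ (o ≠ 1 ∧ d = 0) then n - 1 else 1) ∧
      τ.mem = if (o = 1 ∧ g = 1) ∨ (o ≠ 1 ∧ g = 2)
        then Function.update (Function.update σ.mem e 0) (e + 1) 1 else σ.mem := by
  refine Ends.ofWp ?_ (by decide)
  by_cases ho : o = 1
  · by_cases hg : g = 1
    · have h8' := h8 (Or.inl hg)
      simp [prepare, toTarget, Program.wp, Operand.val, State.setReg, State.setMem, Test.Holds, h0,
        h3, h8', h9, h12, ho, hg]
      refine ⟨by omega, by omega, by omega, by omega, by omega, by omega, ?_⟩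
      repeat refine SameRegs.update (m := σ.mem) ?_ (by decide)
      exact SameRegs.rfl
    · simp [prepare, toTarget, Program.wp, Operand.val, State.setReg, State.setMem, Test.Holds, h0,
        h3, h9, h12, ho, hg]
      refine ⟨by omega, by omega, ?_⟩
      repeat refine SameRegs.update (m := σ.mem) ?_ (by decide)
      exact SameRegs.rfl
  · by_cases hg : g = 2
    · have h8' := h8 (Or.inr hg)
      by_cases hd0 : d = 0
      · simp [prepare, toTarget, Program.wp, Operand.val, State.setReg, State.setMem, Test.Holds,
          h0, h3, h8', h9, h12, ho, hg, hd0]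
        refine ⟨by omega, by omega, by omega, by omega, by omega, ?_⟩
        repeat refine SameRegs.update (m := σ.mem) ?_ (by decide)
        exact SameRegs.rfl
      · simp [prepare, toTarget, Program.wp, Operand.val, State.setReg, State.setMem, Test.Holds,
          h0, h3, h8', h9, h12, ho, hg, hd0]
        refine ⟨by omega, by omega, by omega, by omega, ?_⟩
        repeat refine SameRegs.update (m := σ.mem) ?_ (by decide)
        exact SameRegs.rfl
    · by_cases hd0 : d = 0
      · simp [prepare, toTarget, Program.wp, Operand.val, State.setReg, State.setMem, Test.Holds,
          h0, h3, h9, h12, ho, hg, hd0]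
        refine ⟨by omega, ?_⟩
        repeat refine SameRegs.update (m := σ.mem) ?_ (by decide)
        exact SameRegs.rfl
      · simp [prepare, toTarget, Program.wp, Operand.val, State.setReg, State.setMem, Test.Holds,
          h0, h3, h9, h12, ho, hg, hd0]
        refine ⟨by omega, ?_⟩
        repeat refine SameRegs.update (m := σ.mem) ?_ (by decide)
        exact SameRegs.rfl

theorem setUp_spec {n k s : ℕ} [NeZero n] [Admissible n k s] :
    Ends (1000 * n) setUp (State.input n k s) (6 * n + 10) fun τ =>
      τ.reg 0 = n ∧ τ.reg 2 = s ∧ τ.reg 3 = 0 ∧ τ.reg 4 = 1 ∧ τ.reg 5 = 5 * n ∧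
      (∀ i < n, τ.mem i = word (start n k s) i) ∧
      ∀ i < n, τ.mem (5 * n + i) = word (start n k s) i := by
  classical
  have hn := Admissible.s_lt n k s
  have hs := Admissible.two_le n k (s := s)
  have hlt := Admissible.lt (n := n) (k := k) (s := s)
  have hkn : k < n := by
    have : 1 * k ≤ s * k := Nat.mul_le_mul_right k (by omega)
    omega
  let I : ℕ → State → Prop := fun m τ => m ≤ k ∧ τ.reg 6 = k - m ∧ τ.reg 7 = (k - m) * s ∧
    (∀ i < n, τ.mem i = if ∃ j < k - m, i = j * s then 1 else 0) ∧
    (∀ i < n, τ.mem (5 * n + i) = if ∃ j < k - m, i = j * s then 1 else 0) ∧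
    τ.reg 0 = n ∧ τ.reg 1 = k ∧ τ.reg 2 = s ∧ τ.reg 3 = 0 ∧ τ.reg 4 = 1 ∧ τ.reg 5 = 5 * n
  have hI0 : ∀ τ, I 0 τ → ¬ Test.Holds (.lt (.reg 6) (.reg 1)) τ := by
    rintro τ ⟨-, h6, -, -, -, -, h1, -⟩
    simp only [Test.Holds, Operand.val]
    omega
  refine Ends.seqWp (N := k * (5 + 1) + 1) ?_ (by simp only [Program.cost]; omega)
  simp [Program.wp, Operand.val, State.setReg, State.input]
  refine ⟨by omega, by omega, by omega, by omega, by omega,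
    (Ends.loop I ?_ hI0 k _ ?_).imp le_rfl ?_⟩
  · rintro m τ ⟨hmk, h6, h7, hm1, hm2, h0, h1, h2, h3, h4, h5⟩
    obtain ⟨i, hi⟩ : ∃ i, i = k - (m + 1) := ⟨_, rfl⟩
    rw [← hi] at h6 h7 hm1 hm2
    have him : k - m = i + 1 := by omega
    have hsi : (i + 1) * s ≤ k * s := Nat.mul_le_mul_right s (by omega)
    rw [Nat.add_mul, Nat.one_mul, Nat.mul_comm k] at hsi
    refine ⟨by simp only [Test.Holds, Operand.val]; omega, Ends.ofWp ?_ (by decide)⟩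
    simp [Program.wp, Operand.val, State.setReg, State.setMem, h6, h7, h5, h2]
    have hstep : ∀ x, (∃ j < i + 1, x = j * s) ↔ x = i * s ∨ ∃ j < i, x = j * s := by
      intro x
      constructor
      · rintro ⟨j, hj, hx⟩
        rcases Nat.lt_or_ge j i with h | h
        · exact Or.inr ⟨j, h, hx⟩
        · exact Or.inl (by rw [hx, show j = i by omega])
      · rintro (hx | ⟨j, hj, hx⟩)
        · exact ⟨i, by omega, hx⟩
        · exact ⟨j, by omega, hx⟩
    have e : (i + 1) * s = i * s + s := by rw [Nat.add_mul, Nat.one_mul]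
    refine ⟨by omega, by omega, by omega, by omega, by omega, by omega, ?_⟩
    refine ⟨by omega, by simp [him], by simp [him, e], fun x hx => ?_, fun x hx => ?_, ?_⟩
    · simp only [him, hstep]
      rw [Function.update_of_ne (by omega), Function.update_apply, hm1 x hx]
      by_cases hxi : x = i * s <;> simp [hxi]
    · simp only [him, hstep]
      rw [Function.update_apply, Function.update_of_ne (by omega), hm2 x hx]
      by_cases hxi : x = i * s <;> simp [hxi]
    · simp [h0, h1, h2, h3, h4, h5]
  · refine ⟨le_rfl, by simp, by simp, by simp, by simp, by simp, by simp, by simp, by simp,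
      by simp, ?_⟩
    simp
    omega
  · rintro τ ⟨-, -, -, hm1, hm2, h0, -, h2, h3, h4, h5⟩
    have hw : ∀ i < n, word (start n k s) i = if ∃ j < k - 0, i = j * s then 1 else 0 := by
      intro i hi
      have := word_start (k := k) (s := s) hi
      split_ifs with h
      · exact this.2 h
      · exact (bit_eq_zero_or_one _ _).resolve_right fun h' => h (this.1 h')
    exact ⟨h0, h2, h3, h4, h5, fun i hi => by rw [hm1 i hi, hw i hi],
      fun i hi => by rw [hm2 i hi, hw i hi]⟩

end WordRAM

/-! ### Letters of rotated sources and targets -/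

section
variable {n k s : ℕ} [NeZero n] [Admissible n k s]

theorem word_rot_pow_swapFirst {a : StableSet n k s} (h : IsStable s (swapSet a.1)) {e i : ℕ}
    (he : e + 1 < n) (hi : i < n) : word ((rot n k s ^ e) (swapFirst a)) i =
      if i = e then word a 1 else if i = e + 1 then word a 0 else word ((rot n k s ^ e) a) i := by
  rcases Nat.lt_or_ge i e with hie | hie
  · rw [if_neg (by omega), if_neg (by omega), ← word_periodic,
      ← word_periodic ((rot n k s ^ e) a), show i + n = e + (i + n - e) by omega, word_rot_pow,
      word_rot_pow, word_swapFirst h (by omega), if_neg (by omega), if_neg (by omega)]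
  · obtain ⟨j, rfl⟩ : ∃ j, i = e + j := ⟨i - e, by omega⟩
    rw [word_rot_pow, word_rot_pow, word_swapFirst h (by omega)]
    simp

/-- A vertex is not at once the rotation of a source and of a target. -/
theorem rot_pow_ne_of_isBig {a a' : StableSet n k s} (ha : IsBig s (word a) 0)
    (ha' : IsBig s (word a') 0) (d : ℕ) :
    (rot n k s ^ d) a ≠ (rot n k s ^ (d + 1)) (swapFirst a') := by
  have hs := Admissible.two_le n k (s := s)
  have hn := Admissible.s_lt n k s
  intro h
  have h1 := word_rot_pow a d 2
  have h2 := word_rot_pow (swapFirst a') (d + 1) 1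
  rw [h, word_two_of_isBig ha] at h1
  rw [word_swapFirst (isStable_swapSet_of_isBig ha') (by omega), if_neg (by omega), if_pos rfl,
    ha'.1] at h2
  rw [show d + 1 + 1 = d + 2 by omega, h1] at h2
  omega

theorem word_last_of_isBig {a : StableSet n k s} (ha : IsBig s (word a) 0) {j : ℕ} (hj : 0 < j)
    (hjs : j < s) : word a (n - j) = 0 := by
  have hn := Admissible.s_lt n k s
  refine (bit_eq_zero_or_one a.1 _).resolve_right fun h => ?_
  have h1 := word_stable a h hj hjs
  have h2 := word_periodic a 0
  rw [show n - j + j = 0 + n by omega, h2, ha.1] at h1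
  omega

/-- The letters that the program reads when a vertex is a rotation of a target. -/
theorem word_of_target {a : StableSet n k s} (ha : IsBig s (word a) 0) (hn : 3 < n) (d : ℕ) :
    word ((rot n k s ^ (d + 1)) (swapFirst a)) d ≠ 1 ∧
    word ((rot n k s ^ (d + 1)) (swapFirst a)) (d + 2) = 1 ∧
    word ((rot n k s ^ (d + 1)) (swapFirst a)) (d + 2 + n - s) = 0 := by
  have hs := Admissible.two_le n k (s := s)
  have hsn := Admissible.s_lt n k s
  have hst := isStable_swapSet_of_isBig ha
  refine ⟨?_, ?_, ?_⟩
  · rw [← word_periodic, show d + n = d + 1 + (n - 1) by omega, word_rot_pow,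
      word_swapFirst hst (by omega), if_neg (by omega), if_neg (by omega),
      word_last_of_isBig ha (by omega) (by omega)]
    omega
  · rw [show d + 2 = d + 1 + 1 by omega, word_rot_pow, word_swapFirst hst (by omega),
      if_neg (by omega), if_pos rfl, ha.1]
  · rw [show d + 2 + n - s = d + 1 + (n + 1 - s) by omega, word_rot_pow,
      word_swapFirst hst (by omega), if_neg (by omega), if_neg (by omega),
      show n + 1 - s = n - (s - 1) by omega]
    exact word_last_of_isBig ha (by omega) (by omega)

/-- A 1 with a 0 exactly `s` places before it can move one place to the left, and is then followed
by at least `s` zeros. This undoes the exchange, so the two letters suffice to recognize a possible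
target. -/
theorem exists_target {X : StableSet n k s} {d : ℕ} (h2 : word X (d + 2) = 1)
    (h0 : word X (d + 2 + n - s) = 0) : ∃ a : StableSet n k s, IsBig s (word a) 0 ∧
      X = (rot n k s ^ (d + 1)) (swapFirst a) := by
  have hs := Admissible.two_le n k (s := s)
  have hsn := Admissible.s_lt n k s
  set Y := (rot n k s ^ (d + 1)).symm X with hY
  have hw : word Y = shiftWord (d + 1) (word X) := word_rot_pow_symm X (d + 1)
  have h1 : word Y 1 = 1 := by rw [hw]; exact h2
  have h1' : word Y (n + 1 - s) = 0 := by
    rw [hw, shiftWord, show d + 1 + (n + 1 - s) = d + 2 + n - s by omega]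
    exact h0
  have hst := isStable_swapSet_of_left h1 h1'
  refine ⟨swapFirst Y, ⟨?_, ?_⟩, ?_⟩
  · rw [word_swapFirst hst (by omega), if_pos rfl, h1]
  · rw [word_swapFirst hst (by omega), if_neg (by omega), if_neg (by omega)]
    have := word_stable Y h1 (d := s - 1) (by omega) (by omega)
    rwa [show 1 + (s - 1) = 0 + s by omega] at this
  · rw [swapFirst_swapFirst, hY, Equiv.apply_symm_apply]

end

/-! ### Correctness of one step of the algorithm -/

namespace WordRAM

/-- Two lists of registers that may change. -/
theorem SameRegs.trans {l l' l'' : List ℕ} {σ τ ρ : State} (h : SameRegs l σ τ)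
    (h' : SameRegs l' τ ρ) (hl : ∀ r ∈ l, r ∈ l'') (hl' : ∀ r ∈ l', r ∈ l'') :
    SameRegs l'' σ ρ := fun r hr =>
  (h' r fun h => hr (hl' r h)).trans (h r fun h => hr (hl r h))

variable {n k s : ℕ} [NeZero n] [Admissible n k s]

/-- The state of the program between two steps, at the vertex `X` with the direction `D`. -/
def Encodes (X : StableSet n k s) (D : Bool) (τ : State) : Prop :=
  τ.reg 0 = n ∧ τ.reg 2 = s ∧ τ.reg 3 = offset D ∧ τ.reg 5 = 5 * n ∧
    (∀ i < n, τ.mem i = word X i) ∧ ∀ i < n, τ.mem (5 * n + i) = word (start n k s) i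

/-- Both kinds of candidates are treated alike, as the memory holds a candidate source rotated by
`e`. The word is extended once more because `classify` may have altered it. -/
theorem isGlued_spec {a : StableSet n k s} {g e : ℕ} (hn : 3 < n) (he : e ≤ 2) {σ : State}
    (ha : IsBig s (word a) 0) (h0 : σ.reg 0 = n) (h2 : σ.reg 2 = s) (h8 : σ.reg 8 = e)
    (h9 : σ.reg 9 = g) (hg : g ≠ 0) (hm : ∀ i < n, σ.mem i = word ((rot n k s ^ e) a) i) :
    Ends (1000 * n) isGlued σ (42 * n + 23) fun τ =>
      (∀ i < n, τ.mem i = word ((rot n k s ^ e) a) i) ∧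
      (∀ i, 4 * n ≤ i → τ.mem i = σ.mem i) ∧
      SameRegs [6, 7, 10, 11, 12, 13, 14, 15, 16] σ τ ∧
      (τ.reg 12 = 1 ∧ a ∈ sources n k s ∨ τ.reg 12 = 0 ∧ a ∉ sources n k s) := by
  have hsn := Admissible.s_lt n k s
  have hsh : shiftWord e (word ((rot n k s ^ e) a)) = word a := by
    funext i
    exact word_rot_pow a e i
  refine Ends.seqWp (N := 1 + ((15 * n + 5) + (27 * n + 16))) ?_
    (by simp only [Program.cost]; omega)
  refine ⟨by simp only [Operand.val]; omega, Ends.branch (fun h => ?_) (fun _ => ?_)⟩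
  · simp [Test.Holds, Operand.val, State.setReg, h9, hg] at h
  · refine Ends.seq (extend_spec (by omega) (word_periodic ((rot n k s ^ e) a))
      (bit_le_one ((rot n k s ^ e) a).1) ?_ ?_) ?_
    · simpa [State.setReg] using h0
    · exact hm
    · rintro τ ⟨hm1, hm2, hreg⟩
      have hreg' : SameRegs [6, 7, 12, 13, 14] σ τ :=
        SameRegs.trans (l := [12]) (SameRegs.update (m := σ.mem) SameRegs.rfl (by decide)) hreg
          (by decide) (by decide)
      refine (sourceTest_spec hn hsn he (word_periodic ((rot n k s ^ e) a)) (by rwa [hsh])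
        ((hreg' 0 (by decide)).trans h0) ((hreg' 2 (by decide)).trans h2)
        ((hreg' 8 (by decide)).trans h8) hm1).imp le_rfl ?_
      rintro τ' ⟨hmem, hreg'', h12⟩
      rw [hsh] at h12
      refine ⟨fun i hi => ?_, fun i hi => ?_, hreg'.trans hreg'' (by decide) (by decide), h12⟩
      · rw [hmem, hm1 i (by omega)]
      · rw [hmem, hm2 i hi]
        rfl

theorem isGlued_spec_zero {σ : State} (h9 : σ.reg 9 = 0) :
    Ends (1000 * n) isGlued σ 3 fun τ => τ.mem = σ.mem ∧ SameRegs [12] σ τ ∧ τ.reg 12 = 0 := by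
  have hn := NeZero.pos n
  refine Ends.seqWp (N := 1 + 1) ?_ (by simp only [Program.cost]; omega)
  refine ⟨by simp only [Operand.val]; omega, Ends.branch (fun _ => ?_) (fun h => ?_)⟩
  · refine Ends.ofWp ⟨rfl, ?_, ?_⟩ le_rfl
    · exact SameRegs.update (m := σ.mem) SameRegs.rfl (by decide)
    · simp [State.setReg, Operand.val]
  · simp [Test.Holds, Operand.val, State.setReg, h9] at h

/-- What is known about the successor `X'` of `X`, if `X` has direction `D` and `X'` has `D'`. -/
def IsNext (X X' : StableSet n k s) (D D' : Bool) : Prop :=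
  (∀ a ∈ sources n k s, X = (rot n k s ^ offset D) a →
    X' = (rot n k s ^ (offset D + 1)) (swapFirst a) ∧ D' = !D) ∧
  (∀ a ∈ sources n k s, X = (rot n k s ^ (offset D + 1)) (swapFirst a) →
    X' = (rot n k s ^ offset D) a ∧ D' = !D) ∧
  ((∀ a ∈ sources n k s, X ≠ (rot n k s ^ offset D) a ∧
    X ≠ (rot n k s ^ (offset D + 1)) (swapFirst a)) →
    X' = (if D then rot n k s X else (rot n k s).symm X) ∧ D' = D)

/-- The state before the last rotation: `X'` is obtained by a rotation of the stored vertex. -/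
def Prepared (X' : StableSet n k s) (D' : Bool) (τ : State) : Prop :=
  ∃ (Z : StableSet n k s) (off : ℕ), Encodes Z D' τ ∧ τ.reg 16 = off ∧ 1 ≤ off ∧ off < n ∧
    ∀ i, word X' i = word Z (i + off)

theorem glue_spec {X X' : StableSet n k s} {D D' : Bool} (hX : IsNext X X' D D') {σ : State}
    (hσ : Encodes X D σ) : Ends (1000 * n) glue σ (57 * n + 60) (Prepared X' D') := by
  have hs := Admissible.two_le n k (s := s)
  have hsn := Admissible.s_lt n k s
  obtain ⟨h0, h2, h3, h5, hm, hm'⟩ := hσ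
  obtain ⟨d, hd⟩ : ∃ d, offset D = d := ⟨_, rfl⟩
  have hd1 : d ≤ 1 := by
    rw [← hd, offset]
    split_ifs <;> omega
  obtain ⟨hA, hB, hC⟩ := hX
  rw [hd] at h3 hA hB hC
  have hflip : ∀ {D' : Bool}, D' = !D → offset D' = 1 - d := by
    rintro _ rfl
    rw [← hd]
    cases D <;> rfl
  -- the case without a gluing
  have hnone : ∀ τ : State, SameRegs [3, 6, 7, 8, 9, 10, 11, 12, 13, 14, 15, 16] σ τ →
      (∀ a ∈ sources n k s, X ≠ (rot n k s ^ d) a ∧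
        X ≠ (rot n k s ^ (d + 1)) (swapFirst a)) → τ.reg 3 = d →
      τ.reg 16 = (if d = 0 then n - 1 else 1) → (∀ i < n, τ.mem i = word X i) →
      (∀ i, 4 * n ≤ i → τ.mem i = σ.mem i) → Prepared X' D' τ := by
    intro τ hreg hno h3' h16 hmem hmem'
    obtain ⟨rfl, rfl⟩ := hC hno
    refine ⟨X, _, ⟨(hreg 0 (by decide)).trans h0, (hreg 2 (by decide)).trans h2,
      h3'.trans hd.symm, (hreg 5 (by decide)).trans h5, hmem, fun i hi => ?_⟩, h16, ?_, ?_, ?_⟩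
    · rw [hmem' _ (by omega), hm' i hi]
    · split_ifs <;> omega
    · split_ifs <;> omega
    · intro i
      rw [← hd]
      cases D'
      · exact word_rot_symm X i
      · exact word_rot' X i
  refine (Ends.seq (N' := 20 + ((42 * n + 23) + 10))
    (extend_spec (NeZero.pos n) (word_periodic X) (bit_le_one _) h0 hm) ?_).imp
    (by omega) fun _ => id
  rintro τ₁ ⟨hm1, hm1', hreg1⟩
  refine Ends.seq (classify_spec (by omega) hsn hd1 ((hreg1 0 (by decide)).trans h0)
    ((hreg1 2 (by decide)).trans h2) ((hreg1 3 (by decide)).trans h3)) ?_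
  rintro τ₂ ⟨hreg2, hcase⟩
  have hreg12 : SameRegs [6, 7, 8, 9, 13, 14] σ τ₂ := hreg1.trans hreg2 (by decide) (by decide)
  have r0 := (hreg12 0 (by decide)).trans h0
  have r2 := (hreg12 2 (by decide)).trans h2
  have r3 := (hreg12 3 (by decide)).trans h3
  rcases hcase with ⟨hn3, hv1, hv2, h9, h8, hmem⟩ | ⟨hn3, hv1, hv2, hv3, h9, h8, hmem⟩ |
    ⟨h9, hmem, hcase⟩
  · -- a candidate for a source
    rw [hm1 _ (by omega)] at hv1 hv2
    set a := (rot n k s ^ d).symm X with haX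
    have hXa : X = (rot n k s ^ d) a := by rw [haX, Equiv.apply_symm_apply]
    have hbig : IsBig s (word a) 0 := by
      rw [haX, word_rot_pow_symm]
      exact ⟨hv1, by rw [Nat.zero_add]; exact hv2⟩
    refine Ends.seq (isGlued_spec hn3 (by omega) hbig r0 r2 h8 h9 (by omega) ?_) ?_
    · intro i hi
      rw [hmem, hm1 i (by omega), ← hXa]
    rintro τ₃ ⟨hm3, hm3', hreg3, h12⟩
    have hreg13 := hreg12.trans hreg3 (l'' := [6, 7, 8, 9, 10, 11, 12, 13, 14, 15, 16])
      (by decide) (by decide)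
    refine (prepare_spec (by omega) hd1 (show d ≤ 2 by omega) ((hreg13 0 (by decide)).trans h0)
      ((hreg13 3 (by decide)).trans h3) (fun _ => (hreg3 8 (by decide)).trans h8)
      ((hreg3 9 (by decide)).trans h9) rfl).imp le_rfl ?_
    rintro τ ⟨hreg4, h3', h16, hmem4⟩
    have hreg14 := hreg13.trans hreg4 (l'' := [3, 6, 7, 8, 9, 10, 11, 12, 13, 14, 15, 16])
      (by decide) (by decide)
    rcases h12 with ⟨h12, ha⟩ | ⟨h12, ha⟩
    · rw [h12] at h3' h16 hmem4
      rw [if_pos rfl] at h3'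
      rw [if_pos (Or.inl ⟨rfl, rfl⟩)] at h16 hmem4
      obtain ⟨hX', hD'⟩ := hA a ha hXa
      refine ⟨(rot n k s ^ d) (swapFirst a), _, ⟨(hreg14 0 (by decide)).trans h0,
        (hreg14 2 (by decide)).trans h2, h3'.trans (hflip hD').symm,
        (hreg14 5 (by decide)).trans h5, fun i hi => ?_, fun i hi => ?_⟩, h16, by omega,
        by omega, fun i => ?_⟩
      · rw [word_rot_pow_swapFirst (isStable_swapSet_of_isBig hbig) (by omega) hi, hmem4,
          word_one_of_isBig hbig, hbig.1, Function.update_apply, Function.update_apply, hm3 i hi]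
        split_ifs <;> first | rfl | omega
      · rw [hmem4, Function.update_of_ne (by omega), Function.update_of_ne (by omega),
          hm3' _ (by omega), hmem, hm1' _ (by omega), hm' i hi]
      · rw [hX', pow_succ', Equiv.Perm.mul_apply, word_rot']
    · rw [h12] at h3' h16 hmem4
      rw [if_neg (by omega)] at h3' hmem4
      have e16 : τ.reg 16 = if d = 0 then n - 1 else 1 := by
        rw [h16]
        simp
      refine hnone τ hreg14 (fun a' ha' => ⟨fun h => ?_, fun h => ?_⟩) h3' e16 (fun i hi => ?_)
        fun i hi => ?_
      -- Rotation is injective, so `a` is the only possible source here, and it failed the test;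
      -- being a target is excluded by `rot_pow_ne_of_isBig`.
      · rw [hXa] at h
        exact ha ((Equiv.injective _ h) ▸ ha')
      · rw [hXa] at h
        exact rot_pow_ne_of_isBig hbig ha'.1 d h
      · rw [hmem4, hm3 i hi, ← hXa]
      · rw [hmem4, hm3' i hi, hmem, hm1' i hi]
  · -- a candidate for a target
    rw [hm1 _ (by omega)] at hv1 hv2 hv3
    obtain ⟨a, hbig, hXa⟩ := exists_target hv2 hv3
    have hst := isStable_swapSet_of_isBig hbig
    have hsw := fun i hi => word_rot_pow_swapFirst hst (e := d + 1) (i := i) (by omega) hi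
    rw [word_one_of_isBig hbig, hbig.1, ← hXa] at hsw
    refine Ends.seq (isGlued_spec hn3 (by omega) hbig r0 r2 h8 h9 (by omega) ?_) ?_
    · intro i hi
      have e0 := word_rot_pow a (d + 1) 0
      have e1 := word_rot_pow a (d + 1) 1
      rw [hbig.1, Nat.add_zero] at e0
      rw [word_one_of_isBig hbig] at e1
      rw [hmem, Function.update_apply, Function.update_apply, hm1 i (by omega), hsw i hi]
      split_ifs with c1 c2
      · rw [c1, e1]
      · rw [c2, e0]
      · rfl
    rintro τ₃ ⟨hm3, hm3', hreg3, h12⟩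
    have hreg13 := hreg12.trans hreg3 (l'' := [6, 7, 8, 9, 10, 11, 12, 13, 14, 15, 16])
      (by decide) (by decide)
    refine (prepare_spec (by omega) hd1 (show d + 1 ≤ 2 by omega)
      ((hreg13 0 (by decide)).trans h0)
      ((hreg13 3 (by decide)).trans h3) (fun _ => (hreg3 8 (by decide)).trans h8)
      ((hreg3 9 (by decide)).trans h9) rfl).imp le_rfl ?_
    rintro τ ⟨hreg4, h3', h16, hmem4⟩
    have hreg14 := hreg13.trans hreg4 (l'' := [3, 6, 7, 8, 9, 10, 11, 12, 13, 14, 15, 16])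
      (by decide) (by decide)
    have hmemσ : ∀ i, 4 * n ≤ i → τ₃.mem i = σ.mem i := by
      intro i hi
      rw [hm3' i hi, hmem, Function.update_of_ne (by omega), Function.update_of_ne (by omega),
        hm1' i hi]
    rcases h12 with ⟨h12, ha⟩ | ⟨h12, ha⟩
    · rw [h12] at h3' h16 hmem4
      rw [if_pos rfl] at h3'
      rw [if_neg (by omega)] at h16 hmem4
      obtain ⟨hX', hD'⟩ := hB a ha hXa
      refine ⟨(rot n k s ^ (d + 1)) a, _, ⟨(hreg14 0 (by decide)).trans h0,
        (hreg14 2 (by decide)).trans h2, h3'.trans (hflip hD').symm,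
        (hreg14 5 (by decide)).trans h5, fun i hi => ?_, fun i hi => ?_⟩, h16, by omega,
        by omega, fun i => ?_⟩
      · rw [hmem4, hm3 i hi]
      · rw [hmem4, hmemσ _ (by omega), hm' i hi]
      · rw [hX', pow_succ', Equiv.Perm.mul_apply, word_rot]
    · rw [h12] at h3' h16 hmem4
      rw [if_neg (by omega)] at h3'
      rw [if_pos (Or.inr ⟨by omega, rfl⟩)] at hmem4
      have e16 : τ.reg 16 = if d = 0 then n - 1 else 1 := by
        rw [h16]
        simp
      refine hnone τ hreg14 (fun a' ha' => ⟨fun h => ?_, fun h => ?_⟩) h3' e16 (fun i hi => ?_)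
        fun i hi => ?_
      · rw [hXa] at h
        exact rot_pow_ne_of_isBig ha'.1 hbig d h.symm
      · rw [hXa] at h
        have := Equiv.injective _ h
        rw [← swapFirst_swapFirst a, this, swapFirst_swapFirst] at ha
        exact ha ha'
      · rw [hsw i hi, hmem4, Function.update_apply, Function.update_apply, hm3 i hi]
        split_ifs <;> first | rfl | omega
      · rw [hmem4, Function.update_of_ne (by omega), Function.update_of_ne (by omega), hmemσ i hi]
  · -- no candidate
    refine (Ends.seq (N' := 10) (isGlued_spec_zero (n := n) h9) ?_).imp (by omega) fun _ => id
    rintro τ₃ ⟨hm3, hreg3, h12⟩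
    have hreg13 := hreg12.trans hreg3 (l'' := [6, 7, 8, 9, 10, 11, 12, 13, 14, 15, 16])
      (by decide) (by decide)
    refine (prepare_spec (e := 0) (by omega) hd1 (by omega)
      ((hreg13 0 (by decide)).trans h0)
      ((hreg13 3 (by decide)).trans h3) (fun h => by omega)
      ((hreg3 9 (by decide)).trans h9) h12).imp le_rfl ?_
    rintro τ ⟨hreg4, h3', h16, hmem4⟩
    have hreg14 := hreg13.trans hreg4 (l'' := [3, 6, 7, 8, 9, 10, 11, 12, 13, 14, 15, 16])
      (by decide) (by decide)
    rw [if_neg (by omega)] at h3' hmem4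
    have e16 : τ.reg 16 = if d = 0 then n - 1 else 1 := by
      rw [h16]
      simp
    refine hnone τ hreg14 (fun a ha => ?_) h3' e16 (fun i hi => ?_) fun i hi => ?_
    · have hn3 := three_lt_of_mem_sources ha
      have hc := hcase hn3
      rw [hm1 _ (by omega), hm1 _ (by omega), hm1 _ (by omega), hm1 _ (by omega)] at hc
      constructor
      · rintro rfl
        have h1 := word_rot_pow a d 0
        have h1' := word_rot_pow a d (0 + s)
        rw [ha.1.1] at h1
        rw [ha.1.2, Nat.zero_add] at h1'
        rw [Nat.add_zero] at h1
        rcases hc with ⟨_, h⟩ | ⟨h, _⟩ | ⟨h, _⟩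
        · exact h h1'
        · exact h h1
        · exact h h1
      · rintro rfl
        obtain ⟨t1, t2, t3⟩ := word_of_target ha.1 hn3 d
        rcases hc with ⟨h, _⟩ | ⟨_, h⟩ | ⟨_, h⟩
        · exact t1 h
        · exact h t2
        · exact h t3
    · rw [hmem4, hm3, hmem, hm1 i (by omega)]
    · rw [hmem4, hm3, hmem, hm1' i hi]

theorem advance_spec {X X' : StableSet n k s} {D D' : Bool} (hX : IsNext X X' D D') {σ : State}
    (hσ : Encodes X D σ) : Ends (1000 * n) advance σ (110 * n) fun τ => Encodes X' D' τ ∧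
      (τ.reg 4 = 0 ∧ X' = start n k s ∨ τ.reg 4 = 1 ∧ X' ≠ start n k s) := by
  have hs := Admissible.two_le n k (s := s)
  have hsn := Admissible.s_lt n k s
  -- The passes add up to `81 * n + 70` steps, which is at most `110 * n` because `n ≥ 3`.
  refine (Ends.seq (N' := (15 * n + 5) + (9 * n + 5)) (glue_spec hX hσ) ?_).imp (by omega)
    fun _ => id
  rintro τ ⟨Z, off, ⟨h0, h2, h3, h5, hm, hm'⟩, h16, hoff, hoffn, hZ⟩
  refine Ends.seq (extend_spec (NeZero.pos n) (word_periodic Z) (bit_le_one _) h0 hm) ?_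
  rintro τ₁ ⟨hm1, hm1', hreg1⟩
  refine (rotate_spec (c := word (start n k s)) (by omega) hoff hoffn
    ((hreg1 0 (by decide)).trans h0) ((hreg1 5 (by decide)).trans h5)
    ((hreg1 16 (by decide)).trans h16) (bit_le_one Z.1) hm1 ?_).imp le_rfl ?_
  · intro i hi
    rw [hm1' _ (by omega), hm' i hi]
  rintro τ₂ ⟨hm2, hm2', hreg2, h4⟩
  have hreg := hreg1.trans hreg2 (l'' := [4, 6, 7, 13, 14, 15]) (by decide) (by decide)
  refine ⟨⟨(hreg 0 (by decide)).trans h0, (hreg 2 (by decide)).trans h2,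
    (hreg 3 (by decide)).trans h3, (hreg 5 (by decide)).trans h5, fun i hi => ?_, hm2'⟩,
    h4.imp (fun h => ⟨h.1, ?_⟩) fun h => ⟨h.1, ?_⟩⟩
  · rw [hm2 i hi, hZ]
  · refine word_injective fun i => ?_
    rw [← word_mod, ← word_mod (start n k s), hZ]
    exact h.2 _ (Nat.mod_lt _ (NeZero.pos n))
  · rintro rfl
    obtain ⟨i, hi, hne⟩ := h.2
    exact hne (hZ i).symm

end WordRAM

/-! ### Assembly of the theorem -/

namespace WordRAM

theorem Encodes.stores {n k s : ℕ} [NeZero n] [Admissible n k s] {X : StableSet n k s} {D : Bool}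
    {τ : State} (h : Encodes X D τ) : Stores τ.mem X.1 := fun i => by
  rw [h.2.2.2.2.1 i i.isLt, word, bit_val]

end WordRAM

theorem theorem2 :
    ∃ (P : WordRAM.Program) (c : ℕ), ∀ n k s : ℕ, 1 ≤ k → 2 ≤ s → s * k + 1 ≤ n →
      ∃ (T : ℕ) (out : List WordRAM.Visit) (τ : WordRAM.State)
        (v : StableSet n k s) (C : (stableKneserGraph n k s).Walk v v),
        n < c * n ∧
        WordRAM.Runs (c * n) P (WordRAM.State.input n k s) T out τ ∧
        C.IsHamiltonianCycle ∧
        List.Forall₂ (fun w A => WordRAM.Stores w.mem A.1) out C.support.dropLast ∧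
        List.IsChain (fun t t' => t' ≤ t + c * n) (0 :: out.map WordRAM.Visit.time ++ [T]) := by
  classical
  -- One generous constant bounds the addresses, which stay below `6 * n`, the initialization, and
  -- the at most `110 * n + 2` steps from one visit to the next.
  refine ⟨WordRAM.hamiltonCycle, 1000, fun n k s hk hs hn => ?_⟩
  have : NeZero n := ⟨by omega⟩
  have : Admissible n k s := ⟨hk, hs, hn⟩
  have : Fintype (StableSet n k s) := Fintype.ofFinite _
  have hsn := Admissible.s_lt n k s
  obtain ⟨σ, D, hD, hcyc, hadj, hnext⟩ := exists_successor (n := n) (k := k) (s := s)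
  obtain ⟨N, C, hN, hC, hsupp, hback, hne⟩ :=
    exists_isHamiltonianCycle_of_perm hcyc hadj three_le_card
  obtain ⟨t, τ₁, ht, hrun, h0, h2, h3, h4, h5, hm, hm'⟩ :=
    WordRAM.setUp_spec (n := n) (k := k) (s := s)
  set X : ℕ → StableSet n k s := fun i => σ^[i] (start n k s) with hX
  obtain ⟨T, out, τ, hloop, hout, hchain⟩ := WordRAM.Runs.loop_visit (W := 1000 * n)
    (b := .eq (.reg 4) (.lit 1)) (P := WordRAM.advance) (N := 110 * n)
    -- Here `m` counts the vertices still to be visited; register `4` vanishes only when all `N` are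
    -- done and the start vertex has returned.
    (fun m τ => m ≤ N ∧ WordRAM.Encodes (X (N - m)) (D (X (N - m))) τ ∧
      τ.reg 4 = if m = 0 then 0 else 1)
    (by
      rintro m τ ⟨hm, henc, hreg⟩
      refine ⟨by simpa [WordRAM.Test.Holds, WordRAM.Operand.val] using hreg, ?_⟩
      refine (WordRAM.advance_spec (hnext _) henc).imp le_rfl ?_
      have e : σ (X (N - (m + 1))) = X (N - m) := by
        rw [hX, show N - m = N - (m + 1) + 1 by omega]
        exact (Function.iterate_succ_apply' _ _ _).symm
      rw [e]
      rintro τ' ⟨henc', h⟩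
      refine ⟨by omega, henc', ?_⟩
      split_ifs with h0
      · subst h0
        exact h.elim (fun h => h.1) fun h => absurd hback h.2
      · exact h.elim (fun h => absurd h.2 (hne _ (by omega) (by omega))) fun h => h.1)
    (by
      rintro τ ⟨-, -, hreg⟩
      simp [WordRAM.Test.Holds, WordRAM.Operand.val, hreg])
    N τ₁ ⟨le_rfl, by
      rw [Nat.sub_self]
      exact ⟨h0, h2, by rw [h3, show X 0 = start n k s from rfl, hD]; rfl, h5, hm, hm'⟩,
      by rw [h4, if_neg (by omega)]⟩
  refine ⟨t + T, out.map (WordRAM.Visit.delay t), τ, _, C, by omega,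
    WordRAM.Runs.seq hrun hloop, hC, ?_, ?_⟩
  · rw [hsupp, List.forall₂_map_left_iff]
    -- The loop counts the remaining visits downwards, while the cycle is listed upwards.
    have hrev : (List.range N).map (fun i => σ^[i] (start n k s)) =
        (List.range N).reverse.map fun j => X (N - (j + 1)) := by
      rw [List.range_eq_range', List.reverse_range', List.map_map, ← List.range_eq_range']
      refine List.map_congr_left fun i hi => ?_
      rw [List.mem_range] at hi
      rw [Function.comp_apply, show N - (0 + N - 1 - i + 1) = i by omega]
    rw [hrev, List.forall₂_map_right_iff]
    refine hout.imp ?_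
    rintro v j ⟨σ', ⟨-, henc, -⟩, hv⟩
    change WordRAM.Stores v.mem _
    rw [hv]
    exact henc.stores
  · exact hchain 0 t (1000 * n) (by omega) (by omega)
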